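/- Let $M$ be a smooth manifold of dimension $2n$. An almost bi-Lagrangian structure on $M$ consists of a symplectic form $\omega$ (a smooth, closed, nondegenerate $2$-form) and two smooth rank-$n$ distributions $D_1, D_2$ with $TM = D_1\oplus D_2$ on each of which $\omega$ vanishes; it is bi-Lagrangian if $D_1$ and $D_2$ are also involutive. Let $F$ be the $(1,1)$-tensor field with $F|_{D_1}=\mathrm{id}$, $F|_{D_2}=-\mathrm{id}$, and let $g(X,Y)=\omega(FX,Y)$ be the canonical neutral metric, so that $(g,F)$ is the associated almost para-Hermitian structure. All connections are smooth linear connections on $M$, with torsion $\mathrm{Tor}_\nabla$. A connection $\nabla$ parallelizes $D_i$ if $\nabla_XY$ is tangent to $D_i$ for all vector fields $X$ and all vector fields $Y$ tangent to $D_i$. Consider the following connections. 1. The almost bi-Lagrangian connection: the unique connection that satisfies $\nabla\omega=0$, parallelizes $D_1$ and $D_2$, and has $\mathrm{Tor}_\nabla(X_1,X_2)=0$ for all $X_1\in D_1$, $X_2\in D_2$. 2. The Libermann connection of $(g,F)$: the unique connection with $\nabla F=0$, $\nabla g=0$ and $\mathrm{Tor}_\nabla(X_1,X_2)=0$ whenever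 $FX_1=X_1$, $FX_2=-X_2$. 3. The bi-Lagrangian connection: the unique torsionless connection with $\nabla\omega=0$ that parallelizes $D_1$ and $D_2$. 4. The Levi-Civita connection $\nabla^g$ of $g$: the unique torsionless connection with $\nabla g=0$. 5. The natural connection: $\nabla_XY=\frac{1}{2}\left(\nabla^g_XY+F\nabla^g_X(FY)\right)$. 6. The well-adapted connection: the unique connection that is adapted to the $G$-structure $P$ of all frames $(e_1,\dots,e_n,f_1,\dots,f_n)$ with $e_i\in D_1$, $f_i\in D_2$, $\omega(e_i,f_j)=\delta_{ij}$ (that is, whose connection matrices in local frames of $P$ lie in $\mathfrak g=\{\mathrm{diag}(A,-A^{t}) : A\in\mathfrak{gl}(n,\mathbb R)\}$) and satisfies $\mathrm{trace}(S\circ i_X\mathrm{Tor}_\nabla)=0$ for every vector field $X$ and every endomorphism $S$ in the adjoint bundle of $P$ (that is, with matrix in $\mathfrak g$ in all frames of $P$), where $i_X\mathrm{Tor}_\nabla = \mathrm{Tor}_\nabla(X,\cdot)$. Then: (a) If $(\omega,D_1,D_2)$ is almost bi-Lagrangian, the almost bi-Lagrangian connection and the Libermann connection exist, are unique, and coincide.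 (b) If $(\omega,D_1,D_2)$ is bi-Lagrangian, the well-adapted, the Libermann, the natural, the bi-Lagrangian, the almost bi-Lagrangian and the Levi-Civita connections all exist, are unique, and coincide. -/

import Mathlib

open scoped Manifold ContDiff
open Module

noncomputable section

namespace BiLag

variable {E : Type*} [NormedAddCommGroup E] [NormedSpace ℝ E]
  {M : Type*} [TopologicalSpace M] [ChartedSpace E M]

/-! ### Smooth vector fields, distributions and symplectic forms -/

/-- A global smooth vector field on `M` (an element of `𝒳(M)`). -/
def IsSmoothField [IsManifold 𝓘(ℝ, E) ∞ M] (X : Π x : M, TangentSpace 𝓘(ℝ, E) x) : Prop :=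
  ContMDiff 𝓘(ℝ, E) 𝓘(ℝ, E).tangent ∞ (fun x ↦ (⟨x, X x⟩ : TangentBundle 𝓘(ℝ, E) M))

/-- The derivative `X f` of a function along a vector field. -/
def dirDeriv (X : Π x : M, TangentSpace 𝓘(ℝ, E) x) (f : M → ℝ) (x : M) : ℝ :=
  mvfderiv 𝓘(ℝ, E) f x (X x)

/-- `D` is a smooth distribution of rank `n`: near each point it is spanned by `n` smooth
vector fields that are linearly independent at every point. -/
def IsSmoothDistribution [IsManifold 𝓘(ℝ, E) ∞ M] (n : ℕ)
    (D : Π x : M, Submodule ℝ (TangentSpace 𝓘(ℝ, E) x)) : Prop :=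
  ∀ x₀ : M, ∃ U : Set M, IsOpen U ∧ x₀ ∈ U ∧
    ∃ s : Fin n → Π x : M, TangentSpace 𝓘(ℝ, E) x,
      (∀ i, ContMDiffOn 𝓘(ℝ, E) 𝓘(ℝ, E).tangent ∞
        (fun x ↦ (⟨x, s i x⟩ : TangentBundle 𝓘(ℝ, E) M)) U) ∧
      ∀ x ∈ U, LinearIndependent ℝ (fun i ↦ s i x) ∧
        D x = Submodule.span ℝ (Set.range fun i ↦ s i x)

/-- The vector field `X` is tangent to the distribution `D`. -/
def TangentTo (D : Π x : M, Submodule ℝ (TangentSpace 𝓘(ℝ, E) x))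
    (X : Π x : M, TangentSpace 𝓘(ℝ, E) x) : Prop :=
  ∀ x, X x ∈ D x

/-- `D` is involutive: it is closed under the Lie bracket of vector fields. -/
def IsInvolutive [IsManifold 𝓘(ℝ, E) ∞ M]
    (D : Π x : M, Submodule ℝ (TangentSpace 𝓘(ℝ, E) x)) : Prop :=
  ∀ X Y : Π x : M, TangentSpace 𝓘(ℝ, E) x, IsSmoothField X → IsSmoothField Y →
    TangentTo D X → TangentTo D Y → TangentTo D (VectorField.mlieBracket 𝓘(ℝ, E) X Y)

variable (E M) in
/-- A symplectic form: a smooth, alternating, nondegenerate, closed 2-form. Closedness is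
`dω(X, Y, Z) = 0` for all vector fields, with `dω` expanded by the invariant formula. -/
structure SymplecticForm [IsManifold 𝓘(ℝ, E) ∞ M] where
  form (x : M) : TangentSpace 𝓘(ℝ, E) x →L[ℝ] TangentSpace 𝓘(ℝ, E) x →L[ℝ] ℝ
  smooth : ContMDiff 𝓘(ℝ, E) (𝓘(ℝ, E).prod 𝓘(ℝ, E →L[ℝ] E →L[ℝ] ℝ)) ∞
    (fun x ↦ Bundle.TotalSpace.mk' (E →L[ℝ] E →L[ℝ] ℝ)
      (E := fun x : M ↦ TangentSpace 𝓘(ℝ, E) x →L[ℝ] TangentSpace 𝓘(ℝ, E) x →L[ℝ] ℝ) x (form x))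
  alternating (x : M) (v : TangentSpace 𝓘(ℝ, E) x) : form x v v = 0
  nondegenerate (x : M) (v : TangentSpace 𝓘(ℝ, E) x) : (∀ w, form x v w = 0) → v = 0
  closed (X Y Z : Π x : M, TangentSpace 𝓘(ℝ, E) x) :
    IsSmoothField X → IsSmoothField Y → IsSmoothField Z → ∀ x,
      dirDeriv X (fun y ↦ form y (Y y) (Z y)) x + dirDeriv Y (fun y ↦ form y (Z y) (X y)) x
        + dirDeriv Z (fun y ↦ form y (X y) (Y y)) x
        - form x (VectorField.mlieBracket 𝓘(ℝ, E) X Y x) (Z x)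
        - form x (VectorField.mlieBracket 𝓘(ℝ, E) Y Z x) (X x)
        - form x (VectorField.mlieBracket 𝓘(ℝ, E) Z X x) (Y x) = 0

variable (E M) in
/-- An almost bi-Lagrangian structure on a manifold of dimension `2n`: a symplectic form and two
transversal (i.e. complementary) smooth Lagrangian distributions of rank `n`. -/
structure AlmostBiLagrangian [IsManifold 𝓘(ℝ, E) ∞ M] (n : ℕ) where
  Ω : SymplecticForm E M
  D₁ (x : M) : Submodule ℝ (TangentSpace 𝓘(ℝ, E) x)
  D₂ (x : M) : Submodule ℝ (TangentSpace 𝓘(ℝ, E) x)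
  smooth₁ : IsSmoothDistribution n D₁
  smooth₂ : IsSmoothDistribution n D₂
  isotropic₁ : ∀ x, ∀ v ∈ D₁ x, ∀ w ∈ D₁ x, Ω.form x v w = 0
  isotropic₂ : ∀ x, ∀ v ∈ D₂ x, ∀ w ∈ D₂ x, Ω.form x v w = 0
  transversal (x : M) : IsCompl (D₁ x) (D₂ x)

namespace AlmostBiLagrangian

variable [IsManifold 𝓘(ℝ, E) ∞ M] {n : ℕ}

/-- A bi-Lagrangian structure: both Lagrangian distributions are involutive. -/
def IsBiLagrangian (B : AlmostBiLagrangian E M n) : Prop :=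
  IsInvolutive B.D₁ ∧ IsInvolutive B.D₂

/-- The almost product structure `F`, equal to `id` on `D₁` and to `-id` on `D₂`. -/
def F (B : AlmostBiLagrangian E M n) (x : M) :
    TangentSpace 𝓘(ℝ, E) x →ₗ[ℝ] TangentSpace 𝓘(ℝ, E) x :=
  (B.D₁ x).projection (B.D₂ x) (B.transversal x) -
    (B.D₂ x).projection (B.D₁ x) (B.transversal x).symm

/-- The canonical neutral metric `g(X, Y) = ω(F X, Y)`. -/
def g (B : AlmostBiLagrangian E M n) (x : M) :
    TangentSpace 𝓘(ℝ, E) x →ₗ[ℝ] TangentSpace 𝓘(ℝ, E) x →ₗ[ℝ] ℝ :=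
  LinearMap.mk₂ ℝ (fun v w ↦ B.Ω.form x (B.F x v) w)
    (fun v v' w ↦ by simp) (fun c v w ↦ by simp) (fun v w w' ↦ by simp) (fun c v w ↦ by simp)

theorem F_of_mem₁ (B : AlmostBiLagrangian E M n) {x : M} {v : TangentSpace 𝓘(ℝ, E) x}
    (hv : v ∈ B.D₁ x) : B.F x v = v := by
  simp [F, Submodule.projection_apply_of_mem_left (B.transversal x) hv,
    Submodule.projection_apply_of_mem_right (B.transversal x).symm hv]

theorem F_of_mem₂ (B : AlmostBiLagrangian E M n) {x : M} {v : TangentSpace 𝓘(ℝ, E) x}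
    (hv : v ∈ B.D₂ x) : B.F x v = -v := by
  simp [F, Submodule.projection_apply_of_mem_right (B.transversal x) hv,
    Submodule.projection_apply_of_mem_left (B.transversal x).symm hv]

theorem F_F (B : AlmostBiLagrangian E M n) (x : M) (v : TangentSpace 𝓘(ℝ, E) x) :
    B.F x (B.F x v) = v := by
  obtain ⟨a, ha, b, hb, rfl⟩ : ∃ a ∈ B.D₁ x, ∃ b ∈ B.D₂ x, a + b = v :=
    Submodule.mem_sup.1 ((B.transversal x).sup_eq_top ▸ Submodule.mem_top)
  simp [F_of_mem₁ B ha, F_of_mem₂ B hb]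

/-- `(g, F)` is an almost para-Hermitian structure: `g` is symmetric, `g(FX, FY) = -g(X, Y)`, and
`g` is nondegenerate (it is neutral as `D₁`, `D₂` are complementary and `g`-isotropic). -/
theorem almostParaHermitian (B : AlmostBiLagrangian E M n) (x : M)
    (v w : TangentSpace 𝓘(ℝ, E) x) :
    B.g x v w = B.g x w v ∧ B.g x (B.F x v) (B.F x w) = -B.g x v w ∧
      ((∀ u, B.g x v u = 0) → v = 0) := by
  have anti (p q : TangentSpace 𝓘(ℝ, E) x) : B.Ω.form x p q = -B.Ω.form x q p := by
    have h := B.Ω.alternating x (p + q)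
    simp only [map_add, add_apply, B.Ω.alternating x p,
      B.Ω.alternating x q] at h
    linarith
  have key (p q : TangentSpace 𝓘(ℝ, E) x) :
      B.Ω.form x (B.F x p) q = -B.Ω.form x p (B.F x q) := by
    obtain ⟨a, ha, b, hb, rfl⟩ : ∃ a ∈ B.D₁ x, ∃ b ∈ B.D₂ x, a + b = p :=
      Submodule.mem_sup.1 ((B.transversal x).sup_eq_top ▸ Submodule.mem_top)
    obtain ⟨c, hc, d, hd, rfl⟩ : ∃ c ∈ B.D₁ x, ∃ d ∈ B.D₂ x, c + d = q :=
      Submodule.mem_sup.1 ((B.transversal x).sup_eq_top ▸ Submodule.mem_top)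
    simp only [map_add, map_neg, add_apply, neg_apply,
      F_of_mem₁ B ha, F_of_mem₂ B hb, F_of_mem₁ B hc, F_of_mem₂ B hd,
      B.isotropic₁ x a ha c hc, B.isotropic₂ x b hb d hd]
    ring
  refine ⟨?_, ?_, fun h ↦ ?_⟩
  · change B.Ω.form x (B.F x v) w = B.Ω.form x (B.F x w) v
    rw [key, anti, neg_neg]
  · change B.Ω.form x (B.F x (B.F x v)) (B.F x w) = -B.Ω.form x (B.F x v) w
    rw [F_F, key, neg_neg]
  · have h' := B.Ω.nondegenerate x (B.F x v) h
    rw [← B.F_F x v, h', map_zero]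

end AlmostBiLagrangian

/-! ### Linear connections -/

variable [FiniteDimensional ℝ E] [IsManifold 𝓘(ℝ, E) ∞ M]

variable (E M) in
/-- A (smooth) linear connection on `M`: a smooth covariant derivative on the tangent bundle. -/
structure LinearConnection where
  cov : CovariantDerivative 𝓘(ℝ, E) E (fun x : M ↦ TangentSpace 𝓘(ℝ, E) x)
  smooth : CovariantDerivative.ContMDiffCovariantDerivative cov ∞

namespace LinearConnection

/-- The vector field `∇_X Y`. -/
def deriv (C : LinearConnection E M) (X Y : Π x : M, TangentSpace 𝓘(ℝ, E) x) :
    Π x : M, TangentSpace 𝓘(ℝ, E) x :=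
  fun x ↦ C.cov Y x (X x)

/-- The torsion tensor of `∇`. -/
def tor (C : LinearConnection E M) (x : M) :
    TangentSpace 𝓘(ℝ, E) x →L[ℝ] TangentSpace 𝓘(ℝ, E) x →L[ℝ] TangentSpace 𝓘(ℝ, E) x :=
  C.cov.torsion x

/-- Two linear connections coincide if `∇_X Y = ∇'_X Y` for all smooth vector fields `X`, `Y`.
(A `CovariantDerivative` also has values on non-differentiable fields; these are meaningless and
therefore not compared.) -/
def Coincide (C C' : LinearConnection E M) : Prop :=
  ∀ X Y : Π x : M, TangentSpace 𝓘(ℝ, E) x, IsSmoothField X → IsSmoothField Y →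
    C.deriv X Y = C'.deriv X Y

/-- `C` is the unique linear connection with property `P`. -/
def IsTheUnique (P : LinearConnection E M → Prop) (C : LinearConnection E M) : Prop :=
  P C ∧ ∀ C', P C' → C'.Coincide C

/-- `∇ b = 0` for a field `b` of bilinear forms:
`X (b(Y, Z)) = b(∇_X Y, Z) + b(Y, ∇_X Z)` for all smooth vector fields. -/
def ParallelForm (C : LinearConnection E M)
    (b : Π x : M, TangentSpace 𝓘(ℝ, E) x → TangentSpace 𝓘(ℝ, E) x → ℝ) : Prop :=
  ∀ X Y Z : Π x : M, TangentSpace 𝓘(ℝ, E) x,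
    IsSmoothField X → IsSmoothField Y → IsSmoothField Z → ∀ x,
      dirDeriv X (fun y ↦ b y (Y y) (Z y)) x
        = b x (C.deriv X Y x) (Z x) + b x (Y x) (C.deriv X Z x)

/-- `∇ F = 0` for a field `F` of endomorphisms: `∇_X (F Y) = F (∇_X Y)`. -/
def ParallelEndo (C : LinearConnection E M)
    (F : Π x : M, TangentSpace 𝓘(ℝ, E) x →ₗ[ℝ] TangentSpace 𝓘(ℝ, E) x) : Prop :=
  ∀ X Y : Π x : M, TangentSpace 𝓘(ℝ, E) x, IsSmoothField X → IsSmoothField Y → ∀ x,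
    C.deriv X (fun y ↦ F y (Y y)) x = F x (C.deriv X Y x)

/-- `∇` parallelizes the distribution `D`: `∇_X Y` is tangent to `D` whenever `Y` is. -/
def ParallelDistribution (C : LinearConnection E M)
    (D : Π x : M, Submodule ℝ (TangentSpace 𝓘(ℝ, E) x)) : Prop :=
  ∀ X Y : Π x : M, TangentSpace 𝓘(ℝ, E) x, IsSmoothField X → IsSmoothField Y →
    TangentTo D Y → TangentTo D (C.deriv X Y)

/-- Levi-Civita condition for a pseudo-Riemannian metric `g`: torsionless and `∇ g = 0`. -/
def IsLeviCivita (g : Π x : M, TangentSpace 𝓘(ℝ, E) x →ₗ[ℝ] TangentSpace 𝓘(ℝ, E) x →ₗ[ℝ] ℝ)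
    (C : LinearConnection E M) : Prop :=
  (∀ x, C.tor x = 0) ∧ C.ParallelForm (fun x v w ↦ g x v w)

/-- Libermann condition for an almost para-Hermitian structure `(g, F)`: `∇ F = 0`, `∇ g = 0` and
`Tor(X₁, X₂) = 0` for `X₁ ∈ F⁺`, `X₂ ∈ F⁻` (the `±1`-eigenspaces of `F`). -/
def IsLibermann (g : Π x : M, TangentSpace 𝓘(ℝ, E) x →ₗ[ℝ] TangentSpace 𝓘(ℝ, E) x →ₗ[ℝ] ℝ)
    (F : Π x : M, TangentSpace 𝓘(ℝ, E) x →ₗ[ℝ] TangentSpace 𝓘(ℝ, E) x)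
    (C : LinearConnection E M) : Prop :=
  C.ParallelEndo F ∧ C.ParallelForm (fun x v w ↦ g x v w) ∧
    ∀ x, ∀ v w : TangentSpace 𝓘(ℝ, E) x, F x v = v → F x w = -w → C.tor x v w = 0

/-- The natural connection of an almost para-Hermitian structure `(g, F)`:
`∇_X Y = ½ (∇ᵍ_X Y + F (∇ᵍ_X (F Y)))`, with `∇ᵍ` the Levi-Civita connection of `g`. -/
def IsNatural (g : Π x : M, TangentSpace 𝓘(ℝ, E) x →ₗ[ℝ] TangentSpace 𝓘(ℝ, E) x →ₗ[ℝ] ℝ)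
    (F : Π x : M, TangentSpace 𝓘(ℝ, E) x →ₗ[ℝ] TangentSpace 𝓘(ℝ, E) x)
    (C : LinearConnection E M) : Prop :=
  ∃ L : LinearConnection E M, IsLeviCivita g L ∧
    ∀ X Y : Π x : M, TangentSpace 𝓘(ℝ, E) x, IsSmoothField X → IsSmoothField Y → ∀ x,
      C.deriv X Y x =
        (1 / 2 : ℝ) • (L.deriv X Y x + F x (L.deriv X (fun y ↦ F y (Y y)) x))

/-! ### Connections adapted to a `G`-structure

A `G`-structure is given by its set `P x` of frames at each point, and enters here together with
the Lie algebra `𝔤` of `G` (as a set of matrices). -/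

/-- `∇` is adapted (reducible) to the `G`-structure `P`: in every smooth local frame belonging to
`P`, the connection matrices of `∇` lie in `𝔤`. -/
def IsAdapted {ι : Type*} [Fintype ι]
    (P : Π x : M, Set (Basis ι ℝ (TangentSpace 𝓘(ℝ, E) x))) (𝔤 : Set (Matrix ι ι ℝ))
    (C : LinearConnection E M) : Prop :=
  ∀ (U : Set M) (s : ι → Π x : M, TangentSpace 𝓘(ℝ, E) x), IsOpen U →
    ∀ hs : IsLocalFrameOn 𝓘(ℝ, E) E ∞ s U, (∀ x (hx : x ∈ U), hs.toBasisAt hx ∈ P x) →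
      ∀ x ∈ U, ∀ v : TangentSpace 𝓘(ℝ, E) x, ∃ A ∈ 𝔤, ∀ j,
        C.cov (s j) x v = ∑ i, A i j • s i x

/-- Fibre at `x` of the adjoint bundle of `P`: the endomorphisms of the tangent space whose matrix
in the frames of `P x` lies in `𝔤`. -/
def adjointFibre {ι : Type*} [Fintype ι] [DecidableEq ι]
    (P : Π x : M, Set (Basis ι ℝ (TangentSpace 𝓘(ℝ, E) x))) (𝔤 : Set (Matrix ι ι ℝ)) (x : M) :
    Set (TangentSpace 𝓘(ℝ, E) x →ₗ[ℝ] TangentSpace 𝓘(ℝ, E) x) :=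
  {S | ∀ b ∈ P x, LinearMap.toMatrix b b S ∈ 𝔤}

/-- The condition defining the well-adapted connection of the `G`-structure `P`: `∇` is adapted
to `P` and `trace (S ∘ i_X Tor) = 0` for all `X` and all `S` in the adjoint bundle of `P`. -/
def IsWellAdapted {ι : Type*} [Fintype ι] [DecidableEq ι]
    (P : Π x : M, Set (Basis ι ℝ (TangentSpace 𝓘(ℝ, E) x))) (𝔤 : Set (Matrix ι ι ℝ))
    (C : LinearConnection E M) : Prop :=
  IsAdapted P 𝔤 C ∧
    ∀ x, ∀ S ∈ adjointFibre P 𝔤 x, ∀ v : TangentSpace 𝓘(ℝ, E) x,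
      LinearMap.trace ℝ (TangentSpace 𝓘(ℝ, E) x) (S ∘ₗ (C.tor x v).toLinearMap) = 0

end LinearConnection

/-- The paraunitary Lie algebra `𝔲(n, 𝐀)` of the matrices `diag(A, -Aᵀ)`, i.e. the Lie algebra of
the group of the matrices `diag(A, (Aᵀ)⁻¹)`. -/
def paraunitaryLieAlgebra (n : ℕ) : Set (Matrix (Fin n ⊕ Fin n) (Fin n ⊕ Fin n) ℝ) :=
  {B | ∃ A : Matrix (Fin n) (Fin n) ℝ, B = Matrix.fromBlocks A 0 0 (-A.transpose)}

namespace AlmostBiLagrangian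

variable {n : ℕ}

/-- The `G`-structure of an almost bi-Lagrangian manifold: the frames `(e₁, …, eₙ, f₁, …, fₙ)` with
`eᵢ ∈ D₁`, `fᵢ ∈ D₂` and `ω(eᵢ, fⱼ) = δᵢⱼ`. -/
def adaptedFrames (B : AlmostBiLagrangian E M n) (x : M) :
    Set (Basis (Fin n ⊕ Fin n) ℝ (TangentSpace 𝓘(ℝ, E) x)) :=
  {b | (∀ i, b (Sum.inl i) ∈ B.D₁ x) ∧ (∀ i, b (Sum.inr i) ∈ B.D₂ x) ∧
    ∀ i j, B.Ω.form x (b (Sum.inl i)) (b (Sum.inr j)) = if i = j then 1 else 0}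

/-- Almost bi-Lagrangian connection: `∇` parallelizes `ω`, `D₁` and `D₂`, and `Tor(X₁, X₂) = 0`
for `X₁ ∈ D₁`, `X₂ ∈ D₂`. -/
def IsAlmostBiLagrangianConnection (B : AlmostBiLagrangian E M n)
    (C : LinearConnection E M) : Prop :=
  C.ParallelForm (fun x v w ↦ B.Ω.form x v w) ∧
    C.ParallelDistribution B.D₁ ∧ C.ParallelDistribution B.D₂ ∧
    ∀ x, ∀ v ∈ B.D₁ x, ∀ w ∈ B.D₂ x, C.tor x v w = 0

/-- Bi-Lagrangian connection: a symplectic connection (torsionless with `∇ ω = 0`) that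
parallelizes both foliations. -/
def IsBiLagrangianConnection (B : AlmostBiLagrangian E M n)
    (C : LinearConnection E M) : Prop :=
  (∀ x, C.tor x = 0) ∧ C.ParallelForm (fun x v w ↦ B.Ω.form x v w) ∧
    C.ParallelDistribution B.D₁ ∧ C.ParallelDistribution B.D₂

/-- Well-adapted connection of the `G`-structure of the almost bi-Lagrangian manifold. -/
def IsWellAdaptedConnection (B : AlmostBiLagrangian E M n) (C : LinearConnection E M) : Prop :=
  C.IsWellAdapted B.adaptedFrames (paraunitaryLieAlgebra n)

end AlmostBiLagrangian

end BiLag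

end

open BiLag

section

open scoped Manifold ContDiff Topology
open Module Bundle

set_option linter.unusedSectionVars false

noncomputable section

namespace BiLag

section Infrastructure

variable {E : Type*} [NormedAddCommGroup E] [NormedSpace ℝ E]
  {M : Type*} [TopologicalSpace M] [ChartedSpace E M]

section InverseEquation

variable {V W : Type*} [NormedAddCommGroup V] [NormedSpace ℝ V] [CompleteSpace V]
  [NormedAddCommGroup W] [NormedSpace ℝ W]
  {G : M → V →L[ℝ] W} {a : M → V} {b : M → W} {x : M}

theorem eventually_eq_inverse_apply (hG : ContinuousAt G x) (e : V ≃L[ℝ] W)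
    (he : G x = (e : V →L[ℝ] W)) (h : ∀ᶠ y in 𝓝 x, G y (a y) = b y) :
    a =ᶠ[𝓝 x] fun y ↦ (G y).inverse (b y) := by
  have h1 : ∀ᶠ y in 𝓝 x, G y ∈ Set.range ((↑) : (V ≃L[ℝ] W) → V →L[ℝ] W) :=
    hG (by rw [he]; exact ContinuousLinearEquiv.nhds e)
  filter_upwards [h, h1] with y hy hy1
  obtain ⟨e', he'⟩ := hy1
  rw [← hy, ← he', ContinuousLinearMap.inverse_equiv]
  simp

theorem contMDiffAt_of_clm_apply_eq (hG : ContMDiffAt 𝓘(ℝ, E) 𝓘(ℝ, V →L[ℝ] W) ∞ G x)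
    (hb : ContMDiffAt 𝓘(ℝ, E) 𝓘(ℝ, W) ∞ b x) (e : V ≃L[ℝ] W)
    (he : G x = (e : V →L[ℝ] W)) (h : ∀ᶠ y in 𝓝 x, G y (a y) = b y) :
    ContMDiffAt 𝓘(ℝ, E) 𝓘(ℝ, V) ∞ a x := by
  refine ContMDiffAt.congr_of_eventuallyEq ?_
    (eventually_eq_inverse_apply hG.continuousAt e he h)
  have h2 : ContMDiffAt 𝓘(ℝ, E) 𝓘(ℝ, W →L[ℝ] V) ∞ (fun y ↦ (G y).inverse) x := by
    have h3 := (contDiffAt_map_inverse (n := ∞) e).contMDiffAt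
    rw [← he] at h3
    exact h3.comp x hG
  exact h2.clm_apply hb

theorem mdifferentiableAt_of_clm_apply_eq (hG : ContMDiffAt 𝓘(ℝ, E) 𝓘(ℝ, V →L[ℝ] W) ∞ G x)
    (hb : MDifferentiableAt 𝓘(ℝ, E) 𝓘(ℝ, W) b x) (e : V ≃L[ℝ] W)
    (he : G x = (e : V →L[ℝ] W)) (h : ∀ᶠ y in 𝓝 x, G y (a y) = b y) :
    MDifferentiableAt 𝓘(ℝ, E) 𝓘(ℝ, V) a x := by
  refine MDifferentiableAt.congr_of_eventuallyEq ?_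
    (eventually_eq_inverse_apply hG.continuousAt e he h)
  have h2 : ContMDiffAt 𝓘(ℝ, E) 𝓘(ℝ, W →L[ℝ] V) ∞ (fun y ↦ (G y).inverse) x := by
    have h3 := (contDiffAt_map_inverse (n := ∞) e).contMDiffAt
    rw [← he] at h3
    exact h3.comp x hG
  exact (h2.mdifferentiableAt (by simp)).clm_apply hb

end InverseEquation

variable [IsManifold 𝓘(ℝ, E) ∞ M]

/-! ### Evaluating a symplectic form -/

theorem SymplecticForm.contMDiffAt_apply (Ω : SymplecticForm E M)
    {Y Z : Π x : M, TangentSpace 𝓘(ℝ, E) x} {x : M}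
    (hY : CMDiffAt ∞ (T% Y) x) (hZ : CMDiffAt ∞ (T% Z) x) :
    CMDiffAt ∞ (fun y ↦ Ω.form y (Y y) (Z y)) x := by
  have : ContMDiffAt 𝓘(ℝ, E) (𝓘(ℝ, E).prod 𝓘(ℝ)) ∞
      (fun y ↦ TotalSpace.mk' ℝ (E := Bundle.Trivial M ℝ) y (Ω.form y (Y y) (Z y))) x := by
    apply ContMDiffAt.clm_bundle_apply₂ (F₁ := E) (F₂ := E)
    · exact Ω.smooth x
    · exact hY
    · exact hZ
  simp only [contMDiffAt_totalSpace] at this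
  exact this.2

theorem SymplecticForm.mdifferentiableAt_apply (Ω : SymplecticForm E M)
    {Y Z : Π x : M, TangentSpace 𝓘(ℝ, E) x} {x : M}
    (hY : MDiffAt (T% Y) x) (hZ : MDiffAt (T% Z) x) :
    MDiffAt (fun y ↦ Ω.form y (Y y) (Z y)) x := by
  have : MDifferentiableAt 𝓘(ℝ, E) (𝓘(ℝ, E).prod 𝓘(ℝ))
      (fun y ↦ TotalSpace.mk' ℝ (E := Bundle.Trivial M ℝ) y (Ω.form y (Y y) (Z y))) x := by
    apply MDifferentiableAt.clm_bundle_apply₂ (F₁ := E) (F₂ := E)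
    · exact (Ω.smooth x).mdifferentiableAt (by simp)
    · exact hY
    · exact hZ
  simp only [mdifferentiableAt_totalSpace] at this
  exact this.2

theorem SymplecticForm.neg_swap (Ω : SymplecticForm E M) {x : M} (v w : TangentSpace 𝓘(ℝ, E) x) :
    Ω.form x v w = -Ω.form x w v := by
  have h := Ω.alternating x (v + w)
  simp only [map_add, add_apply, Ω.alternating x v, Ω.alternating x w] at h
  linarith

theorem SymplecticForm.ext_of_form (Ω : SymplecticForm E M) {x : M}
    {v w : TangentSpace 𝓘(ℝ, E) x} (h : ∀ u, Ω.form x v u = Ω.form x w u) : v = w :=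
  sub_eq_zero.1 (Ω.nondegenerate x _ fun u ↦ by simp [h u])

variable [FiniteDimensional ℝ E]

/-! ### Local frames -/

section Frames

variable {ι : Type*} [Fintype ι] {s : ι → Π x : M, TangentSpace 𝓘(ℝ, E) x} {U : Set M} {x : M}

/-- The synthesis map of a family of vector fields, read in the trivialization at `x`. -/
def frameSynthesis (s : ι → Π x : M, TangentSpace 𝓘(ℝ, E) x) (x y : M) : (ι → ℝ) →L[ℝ] E :=
  ∑ i, (ContinuousLinearMap.proj i : (ι → ℝ) →L[ℝ] ℝ).smulRight
    (trivializationAt E (TangentSpace 𝓘(ℝ, E)) x ⟨y, s i y⟩).2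

theorem frameSynthesis_apply {y : M}
    (hy : y ∈ (trivializationAt E (TangentSpace 𝓘(ℝ, E)) x).baseSet) (a : ι → ℝ) :
    frameSynthesis s x y a =
      (trivializationAt E (TangentSpace 𝓘(ℝ, E)) x ⟨y, ∑ i, a i • s i y⟩).2 := by
  have key (v : TangentSpace 𝓘(ℝ, E) y) :
      (trivializationAt E (TangentSpace 𝓘(ℝ, E)) x ⟨y, v⟩).2 =
      (trivializationAt E (TangentSpace 𝓘(ℝ, E)) x).continuousLinearEquivAt ℝ y hy v := rfl
  simp only [frameSynthesis, key, map_sum, map_smul]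
  simp

theorem contMDiffAt_frameSynthesis (h : ∀ i, CMDiffAt ∞ (T% (s i)) x) :
    ContMDiffAt 𝓘(ℝ, E) 𝓘(ℝ, (ι → ℝ) →L[ℝ] E) ∞ (frameSynthesis s x) x := by
  unfold frameSynthesis
  refine contMDiffAt_finsetSum fun i _ ↦ ?_
  have h1 : ContMDiffAt 𝓘(ℝ, E) 𝓘(ℝ, E) ∞
      (fun y ↦ (trivializationAt E (TangentSpace 𝓘(ℝ, E)) x ⟨y, s i y⟩).2) x :=
    (contMDiffAt_section x).1 (h i)
  have h2 : ContMDiff 𝓘(ℝ, E) 𝓘(ℝ, (ι → ℝ) →L[ℝ] E) ∞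
      (fun v : E ↦ (ContinuousLinearMap.proj i : (ι → ℝ) →L[ℝ] ℝ).smulRight v) :=
    ((ContinuousLinearMap.smulRightL ℝ (ι → ℝ) E
      (ContinuousLinearMap.proj i)).contDiff).contMDiff
  exact (h2 _).comp x h1

/-- The synthesis equivalence at the base point. -/
def frameSynthesisEquiv (hs : IsLocalFrameOn 𝓘(ℝ, E) E ∞ s U) (hx : x ∈ U) : (ι → ℝ) ≃L[ℝ] E :=
  ((hs.toBasisAt hx).equivFun.symm.trans
    ((trivializationAt E (TangentSpace 𝓘(ℝ, E)) x).continuousLinearEquivAt ℝ x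
      (FiberBundle.mem_baseSet_trivializationAt' x)).toLinearEquiv).toContinuousLinearEquiv

theorem frameSynthesis_self (hs : IsLocalFrameOn 𝓘(ℝ, E) E ∞ s U) (hx : x ∈ U) :
    frameSynthesis s x x = (frameSynthesisEquiv hs hx : (ι → ℝ) →L[ℝ] E) := by
  refine ContinuousLinearMap.ext fun a ↦ ?_
  rw [frameSynthesis_apply (FiberBundle.mem_baseSet_trivializationAt' x)]
  simp only [frameSynthesisEquiv]
  change _ = (trivializationAt E (TangentSpace 𝓘(ℝ, E)) x).continuousLinearEquivAt ℝ x
      (FiberBundle.mem_baseSet_trivializationAt' x) ((hs.toBasisAt hx).equivFun.symm a)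
  rw [Basis.equivFun_symm_apply]
  simp only [IsLocalFrameOn.toBasisAt_coe]
  rfl

theorem eventually_frameSynthesis_coeff (hs : IsLocalFrameOn 𝓘(ℝ, E) E ∞ s U) (hU : U ∈ 𝓝 x)
    (Y : Π x : M, TangentSpace 𝓘(ℝ, E) x) :
    ∀ᶠ y in 𝓝 x, frameSynthesis s x y (fun i ↦ hs.coeff i y (Y y)) =
      (trivializationAt E (TangentSpace 𝓘(ℝ, E)) x ⟨y, Y y⟩).2 := by
  filter_upwards [hU, (trivializationAt E (TangentSpace 𝓘(ℝ, E)) x).open_baseSet.mem_nhds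
    (FiberBundle.mem_baseSet_trivializationAt' x)] with y hy hy'
  rw [frameSynthesis_apply hy', ← hs.coeff_sum_eq Y hy]

theorem contMDiffAt_frame_coeff (hs : IsLocalFrameOn 𝓘(ℝ, E) E ∞ s U) (hU : IsOpen U) (hx : x ∈ U)
    {Y : Π x : M, TangentSpace 𝓘(ℝ, E) x} (hY : CMDiffAt ∞ (T% Y) x) (i : ι) :
    CMDiffAt ∞ (fun y ↦ hs.coeff i y (Y y)) x :=
  contMDiffAt_pi_space.1 (contMDiffAt_of_clm_apply_eq
    (contMDiffAt_frameSynthesis fun i ↦ hs.contMDiffAt hU hx i)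
    ((contMDiffAt_section x).1 hY) _ (frameSynthesis_self hs hx)
    (eventually_frameSynthesis_coeff hs (hU.mem_nhds hx) Y)) i

theorem mdifferentiableAt_frame_coeff (hs : IsLocalFrameOn 𝓘(ℝ, E) E ∞ s U) (hU : IsOpen U)
    (hx : x ∈ U) {Y : Π x : M, TangentSpace 𝓘(ℝ, E) x} (hY : MDiffAt (T% Y) x) (i : ι) :
    MDiffAt (fun y ↦ hs.coeff i y (Y y)) x := by
  have h := mdifferentiableAt_of_clm_apply_eq
    (contMDiffAt_frameSynthesis fun i ↦ hs.contMDiffAt hU hx i)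
    ((mdifferentiableAt_section 𝓘(ℝ, E) Y).1 hY) _ (frameSynthesis_self hs hx)
    (eventually_frameSynthesis_coeff hs (hU.mem_nhds hx) Y)
  exact ((ContinuousLinearMap.proj (R := ℝ) (φ := fun _ : ι ↦ ℝ) i).contDiff.contMDiff
    |>.mdifferentiable one_ne_zero _).comp x h

/-- The Gram map of a family of vector fields with respect to a symplectic form. -/
def frameGram (Ω : SymplecticForm E M) (s : ι → Π x : M, TangentSpace 𝓘(ℝ, E) x) (y : M) :
    (ι → ℝ) →L[ℝ] (ι → ℝ) :=
  ∑ i, (ContinuousLinearMap.proj i : (ι → ℝ) →L[ℝ] ℝ).smulRight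
    (fun j ↦ Ω.form y (s i y) (s j y))

theorem frameGram_apply (Ω : SymplecticForm E M) (y : M) (a : ι → ℝ) (j : ι) :
    frameGram Ω s y a j = Ω.form y (∑ i, a i • s i y) (s j y) := by
  simp [frameGram]

theorem contMDiffAt_of_form_frame (Ω : SymplecticForm E M) (hs : IsLocalFrameOn 𝓘(ℝ, E) E ∞ s U)
    (hU : IsOpen U) (hx : x ∈ U) {Y : Π x : M, TangentSpace 𝓘(ℝ, E) x}
    (h : ∀ j, CMDiffAt ∞ (fun y ↦ Ω.form y (Y y) (s j y)) x) : CMDiffAt ∞ (T% Y) x := by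
  have hG : ContMDiffAt 𝓘(ℝ, E) 𝓘(ℝ, (ι → ℝ) →L[ℝ] (ι → ℝ)) ∞ (frameGram Ω s) x := by
    unfold frameGram
    refine contMDiffAt_finsetSum fun i _ ↦ ?_
    have h1 : ContMDiffAt 𝓘(ℝ, E) 𝓘(ℝ, ι → ℝ) ∞ (fun y j ↦ Ω.form y (s i y) (s j y)) x :=
      contMDiffAt_pi_space.2 fun j ↦
        Ω.contMDiffAt_apply (hs.contMDiffAt hU hx i) (hs.contMDiffAt hU hx j)
    have h2 : ContMDiff 𝓘(ℝ, ι → ℝ) 𝓘(ℝ, (ι → ℝ) →L[ℝ] (ι → ℝ)) ∞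
        (fun v : ι → ℝ ↦ (ContinuousLinearMap.proj i : (ι → ℝ) →L[ℝ] ℝ).smulRight v) :=
      ((ContinuousLinearMap.smulRightL ℝ (ι → ℝ) (ι → ℝ)
        (ContinuousLinearMap.proj i)).contDiff).contMDiff
    exact (h2 _).comp x h1
  have hinj : Function.Injective (frameGram Ω s x).toLinearMap := by
    refine (injective_iff_map_eq_zero _).2 fun a ha ↦ ?_
    have h0 : ∑ i, a i • s i x = 0 := by
      refine Ω.nondegenerate x _ fun w ↦ ?_
      rw [← (hs.toBasisAt hx).sum_repr w, map_sum]
      refine Finset.sum_eq_zero fun j _ ↦ ?_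
      have h1 := frameGram_apply (s := s) Ω x a j
      rw [show frameGram Ω s x a = 0 from ha] at h1
      rw [map_smul, IsLocalFrameOn.toBasisAt_coe, ← h1]
      simp
    exact funext (Fintype.linearIndependent_iff.1 (hs.linearIndependent hx) a h0)
  have hc := contMDiffAt_of_clm_apply_eq (a := fun y i ↦ hs.coeff i y (Y y)) hG
    (contMDiffAt_pi_space.2 h)
    (LinearEquiv.ofInjectiveEndo _ hinj).toContinuousLinearEquiv
    (by ext; simp) (by
      filter_upwards [hU.mem_nhds hx] with y hy
      ext j
      rw [frameGram_apply, ← hs.coeff_sum_eq Y hy])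
  exact hs.contMDiffAt_of_coeff (fun i ↦ contMDiffAt_pi_space.1 hc i) (hU.mem_nhds hx)

end Frames

theorem exists_localFrame (x : M) : ∃ (U : Set M) (s : Fin (finrank ℝ E) →
    Π x : M, TangentSpace 𝓘(ℝ, E) x), IsOpen U ∧ x ∈ U ∧ IsLocalFrameOn 𝓘(ℝ, E) E ∞ s U :=
  ⟨_, _, (trivializationAt E (TangentSpace 𝓘(ℝ, E)) x).open_baseSet,
    FiberBundle.mem_baseSet_trivializationAt' x,
    (trivializationAt E (TangentSpace 𝓘(ℝ, E)) x).isLocalFrameOn_localFrame_baseSet 𝓘(ℝ, E) ∞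
      (finBasis ℝ E)⟩

theorem SymplecticForm.contMDiffAt_of_form (Ω : SymplecticForm E M) {x : M}
    {Y : Π x : M, TangentSpace 𝓘(ℝ, E) x}
    (h : ∀ Z : Π x : M, TangentSpace 𝓘(ℝ, E) x, CMDiffAt ∞ (T% Z) x →
      CMDiffAt ∞ (fun y ↦ Ω.form y (Y y) (Z y)) x) : CMDiffAt ∞ (T% Y) x := by
  obtain ⟨U, s, hU, hx, hs⟩ := exists_localFrame (E := E) x
  exact contMDiffAt_of_form_frame Ω hs hU hx fun j ↦ h _ (hs.contMDiffAt hU hx j)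

/-- A field of endomorphisms is smooth if it preserves smoothness of vector fields. -/
theorem contMDiffAt_endomorphism {x : M}
    {A : Π x : M, TangentSpace 𝓘(ℝ, E) x →L[ℝ] TangentSpace 𝓘(ℝ, E) x}
    (h : ∀ X : Π x : M, TangentSpace 𝓘(ℝ, E) x, CMDiffAt ∞ (T% X) x →
      CMDiffAt ∞ (T% (fun y ↦ A y (X y))) x) :
    ContMDiffAt 𝓘(ℝ, E) (𝓘(ℝ, E).prod 𝓘(ℝ, E →L[ℝ] E)) ∞
      (fun y ↦ TotalSpace.mk' (E →L[ℝ] E)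
        (E := fun y : M ↦ TangentSpace 𝓘(ℝ, E) y →L[ℝ] TangentSpace 𝓘(ℝ, E) y) y (A y)) x := by
  rw [contMDiffAt_hom_bundle]
  refine ⟨contMDiffAt_id, ?_⟩
  set t := trivializationAt E (TangentSpace 𝓘(ℝ, E)) x with ht
  have hxt : x ∈ t.baseSet := FiberBundle.mem_baseSet_trivializationAt' x
  let b := finBasis ℝ E
  have hs := t.isLocalFrameOn_localFrame_baseSet 𝓘(ℝ, E) ∞ b
  have h1 (i) : ContMDiffAt 𝓘(ℝ, E) 𝓘(ℝ, E) ∞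
      (fun y ↦ (t ⟨y, A y (t.localFrame b i y)⟩).2) x :=
    (contMDiffAt_section x).1 (h _ (hs.contMDiffAt t.open_baseSet hxt i))
  have h2 : ContMDiffAt 𝓘(ℝ, E) 𝓘(ℝ, E →L[ℝ] E) ∞
      (fun y ↦ ∑ i, (b.coord i).toContinuousLinearMap.smulRight
        (t ⟨y, A y (t.localFrame b i y)⟩).2) x := by
    refine contMDiffAt_finsetSum fun i _ ↦ ?_
    have h3 : ContMDiff 𝓘(ℝ, E) 𝓘(ℝ, E →L[ℝ] E) ∞
        (fun v : E ↦ (b.coord i).toContinuousLinearMap.smulRight v) :=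
      ((ContinuousLinearMap.smulRightL ℝ E E (b.coord i).toContinuousLinearMap).contDiff).contMDiff
    exact (h3 _).comp x (h1 i)
  refine h2.congr_of_eventuallyEq ?_
  filter_upwards [t.open_baseSet.mem_nhds hxt] with y hy
  rw [ContinuousLinearMap.inCoordinates_eq hy hy]
  refine ContinuousLinearMap.coe_injective (b.ext fun j ↦ ?_)
  have h4 : (t.continuousLinearEquivAt ℝ y hy).symm (b j) = t.localFrame b j y := by
    simp [hy, Bundle.Trivialization.basisAt]
  have h5 (i) : b.coord i (b j) = if i = j then 1 else 0 := by
    simp [Finsupp.single_apply, eq_comm]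
  simp only [ContinuousLinearMap.coe_coe, ContinuousLinearMap.comp_apply,
    ContinuousLinearEquiv.coe_coe, sum_apply, ContinuousLinearMap.smulRight_apply]
  rw [h4]
  simp only [LinearMap.coe_toContinuousLinearMap', h5]
  simp
  rfl

/-- Every tangent vector extends to a global smooth vector field. -/
theorem exists_smoothField [T2Space M] {x : M} (v : TangentSpace 𝓘(ℝ, E) x) :
    ∃ X : Π x : M, TangentSpace 𝓘(ℝ, E) x, IsSmoothField X ∧ X x = v := by
  obtain ⟨U, s, hU, hx, hs⟩ := exists_localFrame (E := E) x
  obtain ⟨f, hf⟩ := ((SmoothBumpFunction.nhds_basis_tsupport x (I := 𝓘(ℝ, E))).mem_iff).1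
    (hU.mem_nhds hx)
  refine ⟨fun y ↦ f y • ∑ i, hs.coeff i x v • s i y, fun y ↦ ?_, ?_⟩
  · by_cases hy : y ∈ U
    · exact f.contMDiff.contMDiffAt.smul_section (.sum_section fun i _ ↦
        contMDiffAt_const.smul_section (hs.contMDiffAt hU hy i))
    · have h0 : ∀ᶠ z in 𝓝 y, z ∉ tsupport f :=
        (isClosed_tsupport f).isOpen_compl.mem_nhds fun h ↦ hy (hf.2 h)
      refine (contMDiff_zeroSection ℝ (TangentSpace 𝓘(ℝ, E)) y).congr_of_eventuallyEq ?_
      filter_upwards [h0] with z hz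
      simp [image_eq_zero_of_notMem_tsupport hz, zeroSection]
  · have := hs.coeff_sum_eq (fun y ↦ FiberBundle.extend E v y) hx
    simp only [FiberBundle.extend_apply_self] at this
    simp [← this]

end Infrastructure

section

namespace AlmostBiLagrangian

variable {E : Type*} [NormedAddCommGroup E] [NormedSpace ℝ E]
  {M : Type*} [TopologicalSpace M] [ChartedSpace E M] [IsManifold 𝓘(ℝ, E) ∞ M] {n : ℕ}

/-- The almost bi-Lagrangian structure with the two distributions exchanged. -/
def swap (B : AlmostBiLagrangian E M n) : AlmostBiLagrangian E M n where
  Ω := B.Ω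
  D₁ := B.D₂
  D₂ := B.D₁
  smooth₁ := B.smooth₂
  smooth₂ := B.smooth₁
  isotropic₁ := B.isotropic₂
  isotropic₂ := B.isotropic₁
  transversal x := (B.transversal x).symm

/-- The projection onto `D₁` along `D₂`. -/
def proj (B : AlmostBiLagrangian E M n) (x : M) :
    TangentSpace 𝓘(ℝ, E) x →ₗ[ℝ] TangentSpace 𝓘(ℝ, E) x :=
  (B.D₁ x).projection (B.D₂ x) (B.transversal x)

variable (B : AlmostBiLagrangian E M n) {x : M} {v w : TangentSpace 𝓘(ℝ, E) x}

theorem proj_mem (v : TangentSpace 𝓘(ℝ, E) x) : B.proj x v ∈ B.D₁ x := by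
  simp [proj]

theorem proj_of_mem₁ (hv : v ∈ B.D₁ x) : B.proj x v = v :=
  Submodule.projection_apply_of_mem_left (B.transversal x) hv

theorem proj_of_mem₂ (hv : v ∈ B.D₂ x) : B.proj x v = 0 :=
  Submodule.projection_apply_of_mem_right (B.transversal x) hv

theorem proj_add_proj_swap (v : TangentSpace 𝓘(ℝ, E) x) : B.proj x v + B.swap.proj x v = v := by
  obtain ⟨a, ha, b, hb, rfl⟩ : ∃ a ∈ B.D₁ x, ∃ b ∈ B.D₂ x, a + b = v :=
    Submodule.mem_sup.1 ((B.transversal x).sup_eq_top ▸ Submodule.mem_top)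
  rw [map_add, map_add, B.proj_of_mem₁ ha, B.proj_of_mem₂ hb, B.swap.proj_of_mem₁ hb,
    B.swap.proj_of_mem₂ ha]
  simp

theorem F_eq_proj_sub (v : TangentSpace 𝓘(ℝ, E) x) :
    B.F x v = B.proj x v - B.swap.proj x v := rfl

theorem mem_D₁_iff_F : v ∈ B.D₁ x ↔ B.F x v = v := by
  refine ⟨B.F_of_mem₁, fun h ↦ ?_⟩
  have h1 := B.proj_add_proj_swap v
  rw [F_eq_proj_sub] at h
  have h2 : -B.swap.proj x v = B.swap.proj x v := by
    have := h.trans h1.symm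
    rwa [sub_eq_add_neg, add_right_inj] at this
  have : IsAddTorsionFree (TangentSpace 𝓘(ℝ, E) x) := .of_isTorsionFree ℝ _
  rw [neg_eq_self] at h2
  rw [← h1, h2, add_zero]
  exact B.proj_mem v

theorem mem_D₂_iff_F : v ∈ B.D₂ x ↔ B.F x v = -v := by
  have h : B.swap.F x v = -B.F x v := by
    rw [F_eq_proj_sub, F_eq_proj_sub]
    change B.swap.proj x v - B.proj x v = _
    abel
  exact B.swap.mem_D₁_iff_F.trans (by rw [h, neg_eq_iff_eq_neg])

theorem form_proj_left (v w : TangentSpace 𝓘(ℝ, E) x) :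
    B.Ω.form x (B.proj x v) w = B.Ω.form x (B.proj x v) (B.swap.proj x w) := by
  conv_lhs => rw [← B.proj_add_proj_swap w]
  rw [map_add, B.isotropic₁ x _ (B.proj_mem v) _ (B.proj_mem w), zero_add]

theorem form_eq_proj (v w : TangentSpace 𝓘(ℝ, E) x) :
    B.Ω.form x v w = B.Ω.form x (B.proj x v) (B.swap.proj x w) +
      B.Ω.form x (B.swap.proj x v) (B.proj x w) := by
  conv_lhs => rw [← B.proj_add_proj_swap v]
  rw [map_add, add_apply, B.form_proj_left]
  exact congrArg _ (B.swap.form_proj_left v w)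

/-- `D₁` contains its symplectic orthogonal. -/
theorem mem_D₁_of_form (h : ∀ w ∈ B.D₁ x, B.Ω.form x v w = 0) : v ∈ B.D₁ x := by
  have h0 : B.swap.proj x v = 0 := by
    refine B.Ω.nondegenerate x _ fun w ↦ ?_
    have h1 := B.swap.form_proj_left v w
    change B.Ω.form x (B.swap.proj x v) w = B.Ω.form x (B.swap.proj x v) (B.proj x w) at h1
    rw [h1]
    have h2 := h _ (B.proj_mem w)
    rwa [form_eq_proj, B.proj_of_mem₁ (B.proj_mem w), B.swap.proj_of_mem₂ (B.proj_mem w), map_zero,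
      zero_add] at h2
  rw [← B.proj_add_proj_swap v, h0, add_zero]
  exact B.proj_mem v

theorem exists_localFrame (x : M) : ∃ (U : Set M) (s : Fin n ⊕ Fin n →
    Π x : M, TangentSpace 𝓘(ℝ, E) x), IsOpen U ∧ x ∈ U ∧ IsLocalFrameOn 𝓘(ℝ, E) E ∞ s U ∧
      ∀ y ∈ U, (∀ i, s (Sum.inl i) y ∈ B.D₁ y) ∧ ∀ i, s (Sum.inr i) y ∈ B.D₂ y := by
  obtain ⟨U, hU, hx, e, he, he'⟩ := B.smooth₁ x
  obtain ⟨V, hV, hx', f, hf, hf'⟩ := B.smooth₂ x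
  have hr (y : M) : (fun i ↦ Sum.elim e f i y) = Sum.elim (fun i ↦ e i y) (fun i ↦ f i y) :=
    funext fun i ↦ by cases i <;> rfl
  refine ⟨U ∩ V, Sum.elim e f, hU.inter hV, ⟨hx, hx'⟩, ⟨?_, ?_, ?_⟩, ?_⟩
  · intro y hy
    rw [hr]
    refine (he' y hy.1).1.sum_type (hf' y hy.2).1 ?_
    rw [← (he' y hy.1).2, ← (hf' y hy.2).2]
    exact (B.transversal y).disjoint
  · intro y hy
    rw [hr, Set.Sum.elim_range, Submodule.span_union, ← (he' y hy.1).2, ← (hf' y hy.2).2]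
    exact (B.transversal y).sup_eq_top.ge
  · rintro (i | i)
    · exact (he i).mono Set.inter_subset_left
    · exact (hf i).mono Set.inter_subset_right
  · intro y hy
    rw [(he' y hy.1).2, (hf' y hy.2).2]
    exact ⟨fun i ↦ Submodule.subset_span ⟨i, rfl⟩, fun i ↦ Submodule.subset_span ⟨i, rfl⟩⟩

theorem proj_eq_sum_coeff {U : Set M} {s : Fin n ⊕ Fin n → Π x : M, TangentSpace 𝓘(ℝ, E) x}
    (hs : IsLocalFrameOn 𝓘(ℝ, E) E ∞ s U) {y : M} (hy : y ∈ U)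
    (h : (∀ i, s (Sum.inl i) y ∈ B.D₁ y) ∧ ∀ i, s (Sum.inr i) y ∈ B.D₂ y)
    (Y : Π x : M, TangentSpace 𝓘(ℝ, E) x) :
    B.proj y (Y y) = ∑ i : Fin n, hs.coeff (Sum.inl i) y (Y y) • s (Sum.inl i) y := by
  conv_lhs => rw [hs.coeff_sum_eq Y hy]
  simp [map_sum, B.proj_of_mem₁ (h.1 _), B.proj_of_mem₂ (h.2 _)]

variable [FiniteDimensional ℝ E] {Y : Π x : M, TangentSpace 𝓘(ℝ, E) x}

theorem contMDiffAt_proj (hY : CMDiffAt ∞ (T% Y) x) :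
    CMDiffAt ∞ (T% (fun y ↦ B.proj y (Y y))) x := by
  obtain ⟨U, s, hU, hx, hs, h⟩ := B.exists_localFrame x
  have h1 : CMDiffAt ∞ (T% (fun y ↦
      ∑ i : Fin n, hs.coeff (Sum.inl i) y (Y y) • s (Sum.inl i) y)) x :=
    .sum_section fun i _ ↦ (contMDiffAt_frame_coeff hs hU hx hY _).smul_section
      (hs.contMDiffAt hU hx _)
  refine h1.congr_of_eventuallyEq ?_
  filter_upwards [hU.mem_nhds hx] with y hy
  rw [B.proj_eq_sum_coeff hs hy (h y hy)]

theorem mdifferentiableAt_proj (hY : MDiffAt (T% Y) x) :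
    MDiffAt (T% (fun y ↦ B.proj y (Y y))) x := by
  obtain ⟨U, s, hU, hx, hs, h⟩ := B.exists_localFrame x
  have h1 : MDiffAt (T% (fun y ↦
      ∑ i : Fin n, hs.coeff (Sum.inl i) y (Y y) • s (Sum.inl i) y)) x :=
    .sum_section fun i _ ↦ (mdifferentiableAt_frame_coeff hs hU hx hY _).smul_section
      ((hs.contMDiffAt hU hx _).mdifferentiableAt (by simp))
  refine h1.congr_of_eventuallyEq ?_
  filter_upwards [hU.mem_nhds hx] with y hy
  rw [B.proj_eq_sum_coeff hs hy (h y hy)]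

end AlmostBiLagrangian

end

section

variable {E : Type*} [NormedAddCommGroup E] [NormedSpace ℝ E]
  {M : Type*} [TopologicalSpace M] [ChartedSpace E M]

section DirDeriv

variable {X Y : Π x : M, TangentSpace 𝓘(ℝ, E) x} {f g : M → ℝ} {x : M}

theorem dirDeriv_add_field : dirDeriv (X + Y) f x = dirDeriv X f x + dirDeriv Y f x := by
  simp [dirDeriv]

theorem dirDeriv_smul_field : dirDeriv (g • X) f x = g x * dirDeriv X f x := by
  simp [dirDeriv]

theorem dirDeriv_add (hf : MDiffAt f x) (hg : MDiffAt g x) :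
    dirDeriv X (fun y ↦ f y + g y) x = dirDeriv X f x + dirDeriv X g x := by
  have := mvfderiv_add hf hg
  simp only [dirDeriv]
  change mvfderiv 𝓘(ℝ, E) (f + g) x (X x) = _
  rw [this]; rfl

theorem dirDeriv_mul (hf : MDiffAt f x) (hg : MDiffAt g x) :
    dirDeriv X (fun y ↦ f y * g y) x = f x * dirDeriv X g x + dirDeriv X f x * g x := by
  have := mvfderiv_mul hf hg
  simp only [dirDeriv]
  change mvfderiv 𝓘(ℝ, E) (f * g) x (X x) = _
  rw [this]
  simp [mul_comm]

theorem dirDeriv_const (c : ℝ) : dirDeriv X (fun _ ↦ c) x = 0 := by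
  simp [dirDeriv, mvfderiv_const]

theorem dirDeriv_neg : dirDeriv X (fun y ↦ -f y) x = -dirDeriv X f x := by
  simp only [dirDeriv]
  change mvfderiv 𝓘(ℝ, E) (-f) x (X x) = _
  rw [mvfderiv_neg]; rfl

theorem dirDeriv_congr (h : f =ᶠ[𝓝 x] g) : dirDeriv X f x = dirDeriv X g x := by
  simp only [dirDeriv, mvfderiv, h.mfderiv_eq]
  rw [h.eq_of_nhds]

variable [IsManifold 𝓘(ℝ, E) ∞ M]

theorem contMDiffAt_dirDeriv (hX : CMDiffAt ∞ (T% X) x) (hf : CMDiffAt ∞ f x) :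
    CMDiffAt ∞ (dirDeriv X f) x := by
  have h1 := hf.mfderiv_const (m := ∞) (by simp)
  have h2 := ContMDiffAt.clm_apply_of_inCoordinates (b₁ := id) (b₂ := f) h1 hX hf
  rw [contMDiffAt_totalSpace] at h2
  refine h2.2.congr_of_eventuallyEq (Filter.Eventually.of_forall fun y ↦ ?_)
  simp [dirDeriv, mvfderiv]
  rfl

theorem contMDiffAt_mlieBracket (hX : CMDiffAt ∞ (T% X) x) (hY : CMDiffAt ∞ (T% Y) x)
    [CompleteSpace E] : CMDiffAt ∞ (T% (VectorField.mlieBracket 𝓘(ℝ, E) X Y)) x :=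
  have : IsManifold 𝓘(ℝ, E) (((⊤ : ℕ∞) : WithTop ℕ∞) + 1) M := by simpa
  have : IsManifold 𝓘(ℝ, E) (minSmoothness ℝ 2) M := by
    rw [minSmoothness_of_isRCLikeNormedField]; infer_instance
  hX.mlieBracket_vectorField (n := ⊤) (m := ⊤) hY (by simp)

theorem eventually_mdifferentiableAt (hX : CMDiffAt ∞ (T% X) x) :
    ∀ᶠ y in 𝓝 x, MDiffAt (T% X) y := by
  filter_upwards [(contMDiffAt_iff_contMDiffAt_nhds (n := 1) (by simp)).1
    (hX.of_le (by simp))] with y hy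
  exact hy.mdifferentiableAt (by simp)

end DirDeriv

variable [IsManifold 𝓘(ℝ, E) ∞ M] [FiniteDimensional ℝ E] {n : ℕ}

namespace AlmostBiLagrangian

/-- The projection of a vector field onto `D₁` along `D₂`. -/
def projField (B : AlmostBiLagrangian E M n) (X : Π x : M, TangentSpace 𝓘(ℝ, E) x) :
    Π x : M, TangentSpace 𝓘(ℝ, E) x :=
  fun y ↦ B.proj y (X y)

/-- The part of the Koszul-type formula of the almost bi-Lagrangian connection which depends on the
`D₁`-component of the differentiated field `Y`. -/
def halfKoszul (B : AlmostBiLagrangian E M n) (Y X W : Π x : M, TangentSpace 𝓘(ℝ, E) x) (x : M) :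
    ℝ :=
  B.Ω.form x (VectorField.mlieBracket 𝓘(ℝ, E) (B.swap.projField X) (B.projField Y) x)
      (B.swap.projField W x) +
    dirDeriv (B.projField X) (fun y ↦ B.Ω.form y (B.projField Y y) (B.swap.projField W y)) x -
    B.Ω.form x (B.projField Y x)
      (VectorField.mlieBracket 𝓘(ℝ, E) (B.projField X) (B.swap.projField W) x)

/-- The Koszul-type formula for `ω(∇_X Y, W)`, with `∇` the almost bi-Lagrangian connection. -/
def koszul (B : AlmostBiLagrangian E M n) (Y X W : Π x : M, TangentSpace 𝓘(ℝ, E) x) (x : M) : ℝ :=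
  B.halfKoszul Y X W x + B.swap.halfKoszul Y X W x

variable (B : AlmostBiLagrangian E M n) {X X' Y Y' W W' : Π x : M, TangentSpace 𝓘(ℝ, E) x}
  {f : M → ℝ} {x : M}

theorem projField_add : B.projField (X + Y) = B.projField X + B.projField Y :=
  funext fun y ↦ map_add (B.proj y) _ _

theorem projField_smul : B.projField (f • X) = f • B.projField X :=
  funext fun y ↦ map_smul (B.proj y) _ _

theorem projField_mem : B.projField X x ∈ B.D₁ x := B.proj_mem _

theorem mdifferentiableAt_projField (hX : MDiffAt (T% X) x) : MDiffAt (T% (B.projField X)) x :=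
  B.mdifferentiableAt_proj hX

theorem contMDiffAt_projField (hX : CMDiffAt ∞ (T% X) x) : CMDiffAt ∞ (T% (B.projField X)) x :=
  B.contMDiffAt_proj hX

theorem form_projField (X Y : Π x : M, TangentSpace 𝓘(ℝ, E) x) (x : M) :
    B.Ω.form x (B.projField X x) (B.projField Y x) = 0 :=
  B.isotropic₁ x _ (B.proj_mem _) _ (B.proj_mem _)

theorem form_swap_projField (X Y : Π x : M, TangentSpace 𝓘(ℝ, E) x) (x : M) :
    B.Ω.form x (B.swap.projField X x) (B.swap.projField Y x) = 0 :=
  B.isotropic₂ x _ (B.swap.proj_mem _) _ (B.swap.proj_mem _)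

theorem mdifferentiableAt_form_proj (hY : MDiffAt (T% Y) x) (hW : MDiffAt (T% W) x) :
    MDiffAt (fun y ↦ B.Ω.form y (B.projField Y y) (B.swap.projField W y)) x :=
  B.Ω.mdifferentiableAt_apply (B.mdifferentiableAt_projField hY)
    (B.swap.mdifferentiableAt_projField hW)

theorem tensorialAt_halfKoszul_direction :
    TensorialAt 𝓘(ℝ, E) E (fun X ↦ B.halfKoszul Y X W x) x where
  smul {f X} hf hX := by
    have hP := B.mdifferentiableAt_projField hX
    have hQ := B.swap.mdifferentiableAt_projField hX
    simp only [halfKoszul, projField_smul, dirDeriv_smul_field,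
      VectorField.mlieBracket_smul_left hf hP, VectorField.mlieBracket_smul_left hf hQ,
      map_add, add_apply, map_smul, smul_apply, B.form_swap_projField, B.form_projField,
      smul_eq_mul]
    ring
  add {X X'} hX hX' := by
    simp only [halfKoszul, projField_add, dirDeriv_add_field,
      VectorField.mlieBracket_add_left (B.mdifferentiableAt_projField hX)
        (B.mdifferentiableAt_projField hX'),
      VectorField.mlieBracket_add_left (B.swap.mdifferentiableAt_projField hX)
        (B.swap.mdifferentiableAt_projField hX'),
      map_add, add_apply]
    ring

theorem tensorialAt_halfKoszul_test (hY : MDiffAt (T% Y) x) :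
    TensorialAt 𝓘(ℝ, E) E (fun W ↦ B.halfKoszul Y X W x) x where
  smul {f W} hf hW := by
    have hQ := B.swap.mdifferentiableAt_projField hW
    have h := dirDeriv_mul (X := B.projField X) hf (B.mdifferentiableAt_form_proj hY hW)
    simp only [halfKoszul, projField_smul, Pi.smul_apply', VectorField.mlieBracket_smul_right hf hQ,
      map_add, map_smul, smul_eq_mul, h]
    simp only [dirDeriv]
    ring
  add {W W'} hW hW' := by
    have h := dirDeriv_add (X := B.projField X) (B.mdifferentiableAt_form_proj hY hW)
      (B.mdifferentiableAt_form_proj hY hW')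
    simp only [halfKoszul, projField_add, Pi.add_apply,
      VectorField.mlieBracket_add_right (B.swap.mdifferentiableAt_projField hW)
        (B.swap.mdifferentiableAt_projField hW'), map_add, h]
    ring

theorem halfKoszul_add (hY : MDiffAt (T% Y) x) (hY' : MDiffAt (T% Y') x) (hW : MDiffAt (T% W) x) :
    B.halfKoszul (Y + Y') X W x = B.halfKoszul Y X W x + B.halfKoszul Y' X W x := by
  have h := dirDeriv_add (X := B.projField X) (B.mdifferentiableAt_form_proj hY hW)
    (B.mdifferentiableAt_form_proj hY' hW)
  simp only [halfKoszul, projField_add, Pi.add_apply,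
    VectorField.mlieBracket_add_right (B.mdifferentiableAt_projField hY)
      (B.mdifferentiableAt_projField hY'), map_add, add_apply, h]
  ring

theorem halfKoszul_smul (hf : MDiffAt f x) (hY : MDiffAt (T% Y) x) (hW : MDiffAt (T% W) x) :
    B.halfKoszul (f • Y) X W x = f x * B.halfKoszul Y X W x +
      dirDeriv X f x * B.Ω.form x (B.projField Y x) (B.swap.projField W x) := by
  have h := dirDeriv_mul (X := B.projField X) hf (B.mdifferentiableAt_form_proj hY hW)
  have h1 : dirDeriv X f x = dirDeriv (B.projField X) f x + dirDeriv (B.swap.projField X) f x := by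
    rw [← dirDeriv_add_field]
    simp only [dirDeriv]
    congr 1
    exact (B.proj_add_proj_swap _).symm
  rw [h1]
  simp only [halfKoszul, projField_smul, Pi.smul_apply',
    VectorField.mlieBracket_smul_right hf (B.mdifferentiableAt_projField hY),
    map_add, add_apply, map_smul, smul_apply, smul_eq_mul, h]
  simp only [dirDeriv]
  ring

theorem contMDiffAt_halfKoszul (hY : CMDiffAt ∞ (T% Y) x) (hX : CMDiffAt ∞ (T% X) x)
    (hW : CMDiffAt ∞ (T% W) x) : CMDiffAt ∞ (B.halfKoszul Y X W) x := by
  have hPX := B.contMDiffAt_projField hX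
  have hQX := B.swap.contMDiffAt_projField hX
  have hPY := B.contMDiffAt_projField hY
  have hQW := B.swap.contMDiffAt_projField hW
  exact ((B.Ω.contMDiffAt_apply (contMDiffAt_mlieBracket hQX hPY) hQW).add
    (contMDiffAt_dirDeriv hPX (B.Ω.contMDiffAt_apply hPY hQW))).sub
    (B.Ω.contMDiffAt_apply hPY (contMDiffAt_mlieBracket hPX hQW))

end AlmostBiLagrangian

end

section

variable {E : Type*} [NormedAddCommGroup E] [NormedSpace ℝ E]
  {M : Type*} [TopologicalSpace M] [ChartedSpace E M]

variable [IsManifold 𝓘(ℝ, E) ∞ M] [FiniteDimensional ℝ E] {n : ℕ}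

instance (x : M) : FiniteDimensional ℝ (TangentSpace 𝓘(ℝ, E) x) :=
  inferInstanceAs (FiniteDimensional ℝ E)

instance (x : M) : T2Space (TangentSpace 𝓘(ℝ, E) x) :=
  inferInstanceAs (T2Space E)

/-- The symplectic form at a point, as a bilinear form. -/
def SymplecticForm.bilin (Ω : SymplecticForm E M) (x : M) :
    LinearMap.BilinForm ℝ (TangentSpace 𝓘(ℝ, E) x) :=
  LinearMap.mk₂ ℝ (fun v w ↦ Ω.form x v w) (fun v v' w ↦ by simp) (fun c v w ↦ by simp)
    (fun v w w' ↦ by simp) (fun c v w ↦ by simp)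

theorem SymplecticForm.bilin_nondegenerate (Ω : SymplecticForm E M) (x : M) :
    (Ω.bilin x).Nondegenerate :=
  ⟨fun v h ↦ Ω.nondegenerate x v h, fun v h ↦ Ω.nondegenerate x v fun w ↦ by
    rw [Ω.neg_swap, neg_eq_zero]; exact h w⟩

theorem SymplecticForm.exists_endomorphism (Ω : SymplecticForm E M) (x : M)
    (b : TangentSpace 𝓘(ℝ, E) x →L[ℝ] TangentSpace 𝓘(ℝ, E) x →L[ℝ] ℝ) :
    ∃ A : TangentSpace 𝓘(ℝ, E) x →L[ℝ] TangentSpace 𝓘(ℝ, E) x,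
      ∀ v w, Ω.form x (A v) w = b v w := by
  let e := (Ω.bilin x).toDual (Ω.bilin_nondegenerate x)
  let L : TangentSpace 𝓘(ℝ, E) x →ₗ[ℝ] Dual ℝ (TangentSpace 𝓘(ℝ, E) x) :=
    { toFun v := (b v).toLinearMap
      map_add' v w := by ext; simp
      map_smul' c v := by ext; simp }
  refine ⟨LinearMap.toContinuousLinearMap (e.symm.toLinearMap ∘ₗ L), fun v w ↦ ?_⟩
  exact LinearMap.congr_fun (e.apply_symm_apply (L v)) w

namespace AlmostBiLagrangian

variable (B : AlmostBiLagrangian E M n) {X X' Y Y' W W' : Π x : M, TangentSpace 𝓘(ℝ, E) x}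
  {f : M → ℝ} {x : M}

theorem tensorialAt_koszul_direction : TensorialAt 𝓘(ℝ, E) E (fun X ↦ B.koszul Y X W x) x where
  smul hf hX := by
    simp only [koszul, B.tensorialAt_halfKoszul_direction.smul hf hX,
      B.swap.tensorialAt_halfKoszul_direction.smul hf hX, smul_eq_mul, mul_add]
  add hX hX' := by
    simp only [koszul, B.tensorialAt_halfKoszul_direction.add hX hX',
      B.swap.tensorialAt_halfKoszul_direction.add hX hX']
    ring

theorem tensorialAt_koszul_test (hY : MDiffAt (T% Y) x) :
    TensorialAt 𝓘(ℝ, E) E (fun W ↦ B.koszul Y X W x) x where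
  smul hf hW := by
    simp only [koszul, (B.tensorialAt_halfKoszul_test hY).smul hf hW,
      (B.swap.tensorialAt_halfKoszul_test hY).smul hf hW, smul_eq_mul, mul_add]
  add hW hW' := by
    simp only [koszul, (B.tensorialAt_halfKoszul_test hY).add hW hW',
      (B.swap.tensorialAt_halfKoszul_test hY).add hW hW']
    ring

theorem koszul_add (hY : MDiffAt (T% Y) x) (hY' : MDiffAt (T% Y') x) (hW : MDiffAt (T% W) x) :
    B.koszul (Y + Y') X W x = B.koszul Y X W x + B.koszul Y' X W x := by
  simp only [koszul, B.halfKoszul_add hY hY' hW, B.swap.halfKoszul_add hY hY' hW]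
  ring

theorem koszul_smul (hf : MDiffAt f x) (hY : MDiffAt (T% Y) x) (hW : MDiffAt (T% W) x) :
    B.koszul (f • Y) X W x = f x * B.koszul Y X W x + dirDeriv X f x * B.Ω.form x (Y x) (W x) := by
  simp only [koszul, B.halfKoszul_smul hf hY hW, B.swap.halfKoszul_smul hf hY hW]
  rw [B.form_eq_proj (Y x) (W x)]
  simp only [projField]
  change _ + (_ + _ * B.Ω.form x (B.swap.proj x (Y x)) (B.proj x (W x))) = _
  ring

theorem contMDiffAt_koszul (hY : CMDiffAt ∞ (T% Y) x) (hX : CMDiffAt ∞ (T% X) x)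
    (hW : CMDiffAt ∞ (T% W) x) : CMDiffAt ∞ (B.koszul Y X W) x :=
  (B.contMDiffAt_halfKoszul hY hX hW).add (B.swap.contMDiffAt_halfKoszul hY hX hW)

theorem exists_koszul_endomorphism (Y : Π x : M, TangentSpace 𝓘(ℝ, E) x) (x : M) :
    ∃ A : TangentSpace 𝓘(ℝ, E) x →L[ℝ] TangentSpace 𝓘(ℝ, E) x, MDiffAt (T% Y) x →
      ∀ X W : Π x : M, TangentSpace 𝓘(ℝ, E) x, MDiffAt (T% X) x → MDiffAt (T% W) x →
        B.Ω.form x (A (X x)) (W x) = B.koszul Y X W x := by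
  by_cases hY : MDiffAt (T% Y) x
  · obtain ⟨A, hA⟩ := B.Ω.exists_endomorphism x (TensorialAt.mkHom₂ (fun X W ↦ B.koszul Y X W x) x
      (fun _ _ ↦ B.tensorialAt_koszul_direction) (fun _ _ ↦ B.tensorialAt_koszul_test hY))
    exact ⟨A, fun _ X W hX hW ↦ (hA _ _).trans (TensorialAt.mkHom₂_apply _ _ hX hW)⟩
  · exact ⟨0, fun h ↦ (hY h).elim⟩

/-- The underlying operator of the almost bi-Lagrangian connection. -/
def canonicalCov (Y : Π x : M, TangentSpace 𝓘(ℝ, E) x) (x : M) :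
    TangentSpace 𝓘(ℝ, E) x →L[ℝ] TangentSpace 𝓘(ℝ, E) x :=
  (B.exists_koszul_endomorphism Y x).choose

theorem form_canonicalCov (hY : MDiffAt (T% Y) x) (hX : MDiffAt (T% X) x) (hW : MDiffAt (T% W) x) :
    B.Ω.form x (B.canonicalCov Y x (X x)) (W x) = B.koszul Y X W x :=
  (B.exists_koszul_endomorphism Y x).choose_spec hY X W hX hW

theorem isCovariantDerivativeOn_canonicalCov :
    IsCovariantDerivativeOn E (I := 𝓘(ℝ, E)) B.canonicalCov where
  add {Y Y' x} hY hY' _ := by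
    refine ContinuousLinearMap.ext fun v ↦ B.Ω.ext_of_form fun w ↦ ?_
    have hv := FiberBundle.mdifferentiableAt_extend 𝓘(ℝ, E) E v
    have hw := FiberBundle.mdifferentiableAt_extend 𝓘(ℝ, E) E w
    have h1 := B.form_canonicalCov (mdifferentiableAt_add_section hY hY') hv hw
    have h2 := B.form_canonicalCov hY hv hw
    have h3 := B.form_canonicalCov hY' hv hw
    have h4 := B.koszul_add (X := FiberBundle.extend E v) hY hY' hw
    simp only [FiberBundle.extend_apply_self] at h1 h2 h3
    simp only [add_apply, map_add, h2, h3, ← h4]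
    exact h1
  leibniz {Y f x} hY hf _ := by
    refine ContinuousLinearMap.ext fun v ↦ B.Ω.ext_of_form fun w ↦ ?_
    have hv := FiberBundle.mdifferentiableAt_extend 𝓘(ℝ, E) E v
    have hw := FiberBundle.mdifferentiableAt_extend 𝓘(ℝ, E) E w
    have h1 := B.form_canonicalCov (hf.smul_section hY) hv hw
    have h2 := B.form_canonicalCov hY hv hw
    have h4 := B.koszul_smul (X := FiberBundle.extend E v) hf hY hw
    simp only [dirDeriv, FiberBundle.extend_apply_self] at h1 h2 h4
    refine h1.trans (h4.trans ?_)
    simp [h2]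

theorem contMDiffAt_canonicalCov (hY : CMDiffAt ∞ (T% Y) x) :
    ContMDiffAt 𝓘(ℝ, E) (𝓘(ℝ, E).prod 𝓘(ℝ, E →L[ℝ] E)) ∞
      (fun y ↦ TotalSpace.mk' (E →L[ℝ] E)
        (E := fun y : M ↦ TangentSpace 𝓘(ℝ, E) y →L[ℝ] TangentSpace 𝓘(ℝ, E) y) y
        (B.canonicalCov Y y)) x := by
  refine contMDiffAt_endomorphism fun X hX ↦ B.Ω.contMDiffAt_of_form fun W hW ↦ ?_
  refine (B.contMDiffAt_koszul hY hX hW).congr_of_eventuallyEq ?_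
  filter_upwards [eventually_mdifferentiableAt hY, eventually_mdifferentiableAt hX,
    eventually_mdifferentiableAt hW] with y h1 h2 h3
  exact B.form_canonicalCov h1 h2 h3

/-- The almost bi-Lagrangian connection. -/
def canonicalConnection : LinearConnection E M where
  cov := ⟨B.canonicalCov, B.isCovariantDerivativeOn_canonicalCov⟩
  smooth := ⟨⟨fun hY ↦ fun x _ ↦ (B.contMDiffAt_canonicalCov
    ((hY.of_le (by simp)).contMDiffAt Filter.univ_mem)).contMDiffWithinAt⟩⟩

theorem form_canonicalConnection (hY : MDiffAt (T% Y) x) (hX : MDiffAt (T% X) x)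
    (hW : MDiffAt (T% W) x) :
    B.Ω.form x (B.canonicalConnection.deriv X Y x) (W x) = B.koszul Y X W x :=
  B.form_canonicalCov hY hX hW

end AlmostBiLagrangian

end

section

variable {E : Type*} [NormedAddCommGroup E] [NormedSpace ℝ E]
  {M : Type*} [TopologicalSpace M] [ChartedSpace E M]

variable [IsManifold 𝓘(ℝ, E) ∞ M] [FiniteDimensional ℝ E] {n : ℕ}

theorem IsSmoothField.mdifferentiableAt {X : Π x : M, TangentSpace 𝓘(ℝ, E) x}
    (hX : IsSmoothField X) (x : M) : MDiffAt (T% X) x :=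
  (hX x).mdifferentiableAt (by simp)

theorem IsSmoothField.add {X Y : Π x : M, TangentSpace 𝓘(ℝ, E) x}
    (hX : IsSmoothField X) (hY : IsSmoothField Y) : IsSmoothField (X + Y) :=
  ContMDiff.add_section hX hY

theorem IsSmoothField.neg {X : Π x : M, TangentSpace 𝓘(ℝ, E) x}
    (hX : IsSmoothField X) : IsSmoothField (-X) :=
  ContMDiff.neg_section hX

theorem IsSmoothField.projField (B : AlmostBiLagrangian E M n)
    {X : Π x : M, TangentSpace 𝓘(ℝ, E) x} (hX : IsSmoothField X) :
    IsSmoothField (B.projField X) :=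
  fun x ↦ B.contMDiffAt_projField (hX x)

namespace LinearConnection

variable (C : LinearConnection E M) {X X' Y Y' : Π x : M, TangentSpace 𝓘(ℝ, E) x} {x : M}

theorem deriv_add_direction : C.deriv (X + X') Y x = C.deriv X Y x + C.deriv X' Y x :=
  map_add (C.cov Y x) _ _

theorem deriv_add (hY : MDiffAt (T% Y) x) (hY' : MDiffAt (T% Y') x) :
    C.deriv X (Y + Y') x = C.deriv X Y x + C.deriv X Y' x := by
  simp only [deriv, C.cov.isCovariantDerivativeOnUniv.add hY hY', add_apply]

theorem deriv_neg (hY : MDiffAt (T% Y) x) : C.deriv X (-Y) x = -C.deriv X Y x := by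
  have h := C.cov.isCovariantDerivativeOnUniv.smul_const (-1) hY
  simp only [neg_smul, one_smul] at h
  simp only [deriv, h, neg_apply]

theorem tor_apply (hX : MDiffAt (T% X) x) (hY : MDiffAt (T% Y) x) :
    C.tor x (X x) (Y x) =
      C.deriv X Y x - C.deriv Y X x - VectorField.mlieBracket 𝓘(ℝ, E) X Y x :=
  C.cov.torsion_apply hX hY

theorem tor_antisymm (v w : TangentSpace 𝓘(ℝ, E) x) : C.tor x v w = -C.tor x w v :=
  C.cov.torsion_antisymm v w

end LinearConnection

namespace AlmostBiLagrangian

variable (B : AlmostBiLagrangian E M n) {X X' Y Y' Z W W' : Π x : M, TangentSpace 𝓘(ℝ, E) x}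
  {f : M → ℝ} {x : M} {C C' : LinearConnection E M}

theorem swap_Ω : B.swap.Ω = B.Ω := rfl

theorem swap_swap : B.swap.swap = B := rfl

theorem projField_of_tangentTo₁ (hX : TangentTo B.D₁ X) : B.projField X = X :=
  funext fun y ↦ B.proj_of_mem₁ (hX y)

theorem projField_of_tangentTo₂ (hX : TangentTo B.D₂ X) : B.projField X = 0 :=
  funext fun y ↦ B.proj_of_mem₂ (hX y)

theorem swap_projField_of_tangentTo₁ (hX : TangentTo B.D₁ X) : B.swap.projField X = 0 :=
  B.swap.projField_of_tangentTo₂ hX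

theorem swap_projField_of_tangentTo₂ (hX : TangentTo B.D₂ X) : B.swap.projField X = X :=
  B.swap.projField_of_tangentTo₁ hX

theorem tangentTo_projField (X : Π x : M, TangentSpace 𝓘(ℝ, E) x) :
    TangentTo B.D₁ (B.projField X) :=
  fun _ ↦ B.projField_mem

theorem tangentTo_swap_projField (X : Π x : M, TangentSpace 𝓘(ℝ, E) x) :
    TangentTo B.D₂ (B.swap.projField X) :=
  B.swap.tangentTo_projField X

theorem projField_add_swap (X : Π x : M, TangentSpace 𝓘(ℝ, E) x) :
    B.projField X + B.swap.projField X = X :=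
  funext fun _ ↦ B.proj_add_proj_swap _

theorem exists_smoothField_mem₁ [T2Space M] {v : TangentSpace 𝓘(ℝ, E) x} (hv : v ∈ B.D₁ x) :
    ∃ X, IsSmoothField X ∧ TangentTo B.D₁ X ∧ X x = v := by
  obtain ⟨X, hX, rfl⟩ := exists_smoothField v
  exact ⟨B.projField X, hX.projField B, B.tangentTo_projField X, B.proj_of_mem₁ hv⟩

theorem exists_smoothField_mem₂ [T2Space M] {v : TangentSpace 𝓘(ℝ, E) x} (hv : v ∈ B.D₂ x) :
    ∃ X, IsSmoothField X ∧ TangentTo B.D₂ X ∧ X x = v :=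
  B.swap.exists_smoothField_mem₁ hv

/-- The connection satisfies the Koszul-type formula of the almost bi-Lagrangian connection. -/
def SatisfiesKoszul (C : LinearConnection E M) : Prop :=
  ∀ X Y W : Π x : M, TangentSpace 𝓘(ℝ, E) x, IsSmoothField X → IsSmoothField Y →
    IsSmoothField W → ∀ x, B.Ω.form x (C.deriv X Y x) (W x) = B.koszul Y X W x

variable {B}

theorem satisfiesKoszul_canonicalConnection : B.SatisfiesKoszul B.canonicalConnection :=
  fun _ _ _ hX hY hW x ↦ B.form_canonicalConnection (hY.mdifferentiableAt x)
    (hX.mdifferentiableAt x) (hW.mdifferentiableAt x)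

theorem SatisfiesKoszul.swap (h : B.SatisfiesKoszul C) : B.swap.SatisfiesKoszul C :=
  fun X Y W hX hY hW x ↦ (h X Y W hX hY hW x).trans (add_comm _ _)

theorem SatisfiesKoszul.coincide [T2Space M] (h : B.SatisfiesKoszul C) (h' : B.SatisfiesKoszul C') :
    C.Coincide C' := by
  refine fun X Y hX hY ↦ funext fun x ↦ B.Ω.ext_of_form fun w ↦ ?_
  obtain ⟨W, hW, rfl⟩ := exists_smoothField w
  rw [h X Y W hX hY hW, h' X Y W hX hY hW]

theorem halfKoszul_of_tangentTo₂ (hY : TangentTo B.D₂ Y) : B.halfKoszul Y X W x = 0 := by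
  simp [halfKoszul, B.projField_of_tangentTo₂ hY, dirDeriv_const]

theorem halfKoszul_of_tangentTo₁_test (hW : TangentTo B.D₁ W) : B.halfKoszul Y X W x = 0 := by
  simp [halfKoszul, B.swap_projField_of_tangentTo₁ hW, dirDeriv_const]

theorem SatisfiesKoszul.parallelDistribution₁ [T2Space M] (h : B.SatisfiesKoszul C) :
    C.ParallelDistribution B.D₁ := by
  refine fun X Y hX hY hYD x ↦ B.mem_D₁_of_form fun w hw ↦ ?_
  obtain ⟨W, hW, hWD, rfl⟩ := B.exists_smoothField_mem₁ hw
  rw [h X Y W hX hY hW, koszul, halfKoszul_of_tangentTo₁_test hWD,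
    halfKoszul_of_tangentTo₂ (B := B.swap) hYD, add_zero]

theorem halfKoszul_sub_swap :
    B.halfKoszul Y X Z x - B.swap.halfKoszul Z X Y x =
      dirDeriv X (fun y ↦ B.Ω.form y (B.projField Y y) (B.swap.projField Z y)) x := by
  have h1 : (fun y ↦ B.Ω.form y (B.swap.projField Z y) (B.projField Y y)) =
      fun y ↦ -B.Ω.form y (B.projField Y y) (B.swap.projField Z y) :=
    funext fun y ↦ B.Ω.neg_swap _ _
  have h2 (f : M → ℝ) :
      dirDeriv X f x = dirDeriv (B.projField X) f x + dirDeriv (B.swap.projField X) f x := by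
    rw [← dirDeriv_add_field, B.projField_add_swap]
  simp only [halfKoszul, swap_Ω, swap_swap, h1, dirDeriv_neg]
  rw [h2, B.Ω.neg_swap (B.swap.projField Z x),
    B.Ω.neg_swap (B.projField Y x) (VectorField.mlieBracket 𝓘(ℝ, E) _ _ _)]
  ring

theorem SatisfiesKoszul.parallelForm (h : B.SatisfiesKoszul C) :
    C.ParallelForm (fun x v w ↦ B.Ω.form x v w) := by
  intro X Y Z hX hY hZ x
  have h1 := halfKoszul_sub_swap (B := B) (X := X) (Y := Y) (Z := Z) (x := x)
  have h2 := halfKoszul_sub_swap (B := B.swap) (X := X) (Y := Y) (Z := Z) (x := x)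
  have h3 : dirDeriv X (fun y ↦ B.Ω.form y (Y y) (Z y)) x =
      dirDeriv X (fun y ↦ B.Ω.form y (B.projField Y y) (B.swap.projField Z y)) x +
      dirDeriv X (fun y ↦ B.Ω.form y (B.swap.projField Y y) (B.projField Z y)) x := by
    refine Eq.trans ?_ (dirDeriv_add
      (B.mdifferentiableAt_form_proj (hY.mdifferentiableAt x) (hZ.mdifferentiableAt x))
      (B.swap.mdifferentiableAt_form_proj (hY.mdifferentiableAt x) (hZ.mdifferentiableAt x)))
    exact congrArg (fun f ↦ dirDeriv X f x) (funext fun y ↦ B.form_eq_proj _ _)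
  simp only [swap_Ω, swap_swap] at h2
  beta_reduce
  rw [h3, ← h1, ← h2, h X Y Z hX hY hZ, B.Ω.neg_swap (Y x), h X Z Y hX hZ hY]
  simp only [koszul]
  ring

theorem SatisfiesKoszul.tor_eq_zero [T2Space M] (h : B.SatisfiesKoszul C)
    {v w : TangentSpace 𝓘(ℝ, E) x} (hv : v ∈ B.D₁ x) (hw : w ∈ B.D₂ x) : C.tor x v w = 0 := by
  obtain ⟨X, hX, hXD, rfl⟩ := B.exists_smoothField_mem₁ hv
  obtain ⟨Y, hY, hYD, rfl⟩ := B.exists_smoothField_mem₂ hw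
  refine B.Ω.nondegenerate x _ fun u ↦ ?_
  obtain ⟨W, hW, rfl⟩ := exists_smoothField u
  rw [C.tor_apply (hX.mdifferentiableAt x) (hY.mdifferentiableAt x)]
  simp only [map_sub, sub_apply]
  rw [h X Y W hX hY hW, h Y X W hY hX hW, koszul, koszul, halfKoszul_of_tangentTo₂ hYD,
    halfKoszul_of_tangentTo₂ (B := B.swap) hXD]
  conv_lhs => rw [← B.proj_add_proj_swap (W x)]
  simp only [halfKoszul, swap_Ω, swap_swap, B.projField_of_tangentTo₁ hXD,
    B.projField_of_tangentTo₂ hYD, B.swap_projField_of_tangentTo₁ hXD,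
    B.swap_projField_of_tangentTo₂ hYD]
  rw [VectorField.mlieBracket_swap_apply (V := Y)]
  simp [dirDeriv, projField]

theorem SatisfiesKoszul.isAlmostBiLagrangianConnection [T2Space M] (h : B.SatisfiesKoszul C) :
    B.IsAlmostBiLagrangianConnection C :=
  ⟨h.parallelForm, h.parallelDistribution₁, h.swap.parallelDistribution₁,
    fun _ _ hv _ hw ↦ h.tor_eq_zero hv hw⟩

theorem IsAlmostBiLagrangianConnection.swap (h : B.IsAlmostBiLagrangianConnection C) :
    B.swap.IsAlmostBiLagrangianConnection C :=
  ⟨h.1, h.2.2.1, h.2.1, fun x v hv w hw ↦ by rw [C.tor_antisymm, h.2.2.2 x w hw v hv, neg_zero]⟩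

theorem IsAlmostBiLagrangianConnection.form_deriv_projField
    (h : B.IsAlmostBiLagrangianConnection C) (hX : IsSmoothField X) (hY : IsSmoothField Y)
    (hW : IsSmoothField W) :
    B.Ω.form x (C.deriv X (B.projField Y) x) (W x) = B.halfKoszul Y X W x := by
  obtain ⟨hω, h1, h2, ht⟩ := h
  have hPX := hX.projField B
  have hQX := hX.projField B.swap
  have hPY := hY.projField B
  have hQW := hW.projField B.swap
  have hd {X Y} (hX : IsSmoothField X) (hY : IsSmoothField Y) (hX' : TangentTo B.D₁ X)
      (hY' : TangentTo B.D₂ Y) :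
      C.deriv X Y x - C.deriv Y X x = VectorField.mlieBracket 𝓘(ℝ, E) X Y x := by
    have := ht x _ (hX' x) _ (hY' x)
    rwa [C.tor_apply (hX.mdifferentiableAt x) (hY.mdifferentiableAt x), sub_eq_zero] at this
  have e1 := hd hPY hQX (B.tangentTo_projField Y) (B.tangentTo_swap_projField X)
  have e2 := hd hPX hQW (B.tangentTo_projField X) (B.tangentTo_swap_projField W)
  have e3 := hω _ _ _ hPX hPY hQW x
  have e4 : B.Ω.form x (C.deriv X (B.projField Y) x) (W x) =
      B.Ω.form x (C.deriv X (B.projField Y) x) (B.swap.projField W x) := by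
    have hm := h1 X _ hX hPY (B.tangentTo_projField Y) x
    conv_lhs => rw [← B.proj_of_mem₁ hm, B.form_proj_left, B.proj_of_mem₁ hm]
    rfl
  have e5 : B.Ω.form x (C.deriv (B.projField Y) (B.swap.projField X) x)
      (B.swap.projField W x) = 0 :=
    B.isotropic₂ x _ (h2 _ _ hPY hQX (B.tangentTo_swap_projField X) x) _
      (B.tangentTo_swap_projField W x)
  have e6 : B.Ω.form x (B.projField Y x) (C.deriv (B.swap.projField W) (B.projField X) x) = 0 :=
    B.isotropic₁ x _ (B.tangentTo_projField Y x) _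
      (h1 _ _ hQW hPX (B.tangentTo_projField X) x)
  have e7 : C.deriv X (B.projField Y) x = C.deriv (B.projField X) (B.projField Y) x +
      C.deriv (B.swap.projField X) (B.projField Y) x := by
    rw [← C.deriv_add_direction, B.projField_add_swap]
  rw [e4, e7, halfKoszul, VectorField.mlieBracket_swap_apply, ← e1, e3, ← e2]
  simp only [map_add, map_sub, map_neg, add_apply, sub_apply, neg_apply, e5, e6]
  ring

theorem IsAlmostBiLagrangianConnection.satisfiesKoszul (h : B.IsAlmostBiLagrangianConnection C) :
    B.SatisfiesKoszul C := by
  intro X Y W hX hY hW x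
  rw [koszul, ← h.form_deriv_projField hX hY hW, ← h.swap.form_deriv_projField hX hY hW, swap_Ω,
    ← add_apply, ← map_add, ← C.deriv_add ((hY.projField B).mdifferentiableAt x)
    ((hY.projField B.swap).mdifferentiableAt x), B.projField_add_swap]

theorem isTheUnique_isAlmostBiLagrangianConnection [T2Space M] :
    LinearConnection.IsTheUnique B.IsAlmostBiLagrangianConnection B.canonicalConnection :=
  ⟨satisfiesKoszul_canonicalConnection.isAlmostBiLagrangianConnection,
    fun _ h ↦ h.satisfiesKoszul.coincide satisfiesKoszul_canonicalConnection⟩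

end AlmostBiLagrangian

end

section

variable {E : Type*} [NormedAddCommGroup E] [NormedSpace ℝ E]
  {M : Type*} [TopologicalSpace M] [ChartedSpace E M]

variable [IsManifold 𝓘(ℝ, E) ∞ M] [FiniteDimensional ℝ E] {n : ℕ}

namespace AlmostBiLagrangian

variable (B : AlmostBiLagrangian E M n) {X Y Z : Π x : M, TangentSpace 𝓘(ℝ, E) x}
  {x : M} {C C' : LinearConnection E M}

theorem g_apply (v w : TangentSpace 𝓘(ℝ, E) x) : B.g x v w = B.Ω.form x (B.F x v) w := rfl

theorem F_field_eq (Y : Π x : M, TangentSpace 𝓘(ℝ, E) x) :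
    (fun y ↦ B.F y (Y y)) = B.projField Y + -B.swap.projField Y :=
  funext fun _ ↦ sub_eq_add_neg _ _

theorem isSmoothField_F (hY : IsSmoothField Y) : IsSmoothField (fun y ↦ B.F y (Y y)) := by
  rw [F_field_eq]
  exact (hY.projField B).add (hY.projField B.swap).neg

theorem mdifferentiableAt_F (hY : MDiffAt (T% Y) x) : MDiffAt (T% (fun y ↦ B.F y (Y y))) x := by
  have h : MDiffAt (T% (B.projField Y + -B.swap.projField Y)) x :=
    mdifferentiableAt_add_section (B.mdifferentiableAt_projField hY)
      (mdifferentiableAt_neg_section (B.swap.mdifferentiableAt_projField hY))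
  rwa [← F_field_eq] at h

variable {B}

/-! ### Libermann connections -/

theorem IsAlmostBiLagrangianConnection.parallelEndo (h : B.IsAlmostBiLagrangianConnection C) :
    C.ParallelEndo B.F := by
  intro X Y hX hY x
  have hP := hY.projField B
  have hQ := hY.projField B.swap
  have e1 := B.F_of_mem₁ (h.2.1 X _ hX hP (B.tangentTo_projField Y) x)
  have e2 := B.F_of_mem₂ (h.2.2.1 X _ hX hQ (B.tangentTo_swap_projField Y) x)
  rw [F_field_eq, C.deriv_add (hP.mdifferentiableAt x) (hQ.neg.mdifferentiableAt x),
    C.deriv_neg (hQ.mdifferentiableAt x)]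
  conv_rhs => rw [← B.projField_add_swap Y]
  rw [C.deriv_add (hP.mdifferentiableAt x) (hQ.mdifferentiableAt x), map_add, e1, e2]

theorem _root_.BiLag.LinearConnection.ParallelEndo.parallelDistribution₁
    (h : C.ParallelEndo B.F) : C.ParallelDistribution B.D₁ := by
  intro X Y hX hY hYD x
  have h1 := h X Y hX hY x
  rw [show (fun y ↦ B.F y (Y y)) = Y from funext fun y ↦ B.F_of_mem₁ (hYD y)] at h1
  exact B.mem_D₁_iff_F.2 h1.symm

theorem _root_.BiLag.LinearConnection.ParallelEndo.parallelDistribution₂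
    (h : C.ParallelEndo B.F) : C.ParallelDistribution B.D₂ := by
  intro X Y hX hY hYD x
  have h1 := h X Y hX hY x
  rw [show (fun y ↦ B.F y (Y y)) = -Y from funext fun y ↦ B.F_of_mem₂ (hYD y),
    C.deriv_neg (hY.mdifferentiableAt x)] at h1
  exact B.mem_D₂_iff_F.2 h1.symm

theorem isLibermann_iff : LinearConnection.IsLibermann B.g B.F C ↔
    B.IsAlmostBiLagrangianConnection C := by
  refine ⟨fun ⟨hF, hg, ht⟩ ↦
    ⟨?_, hF.parallelDistribution₁, hF.parallelDistribution₂, ?_⟩, fun h ↦ ⟨h.parallelEndo, ?_, ?_⟩⟩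
  · intro X Y Z hX hY hZ x
    have h1 := hg X _ Z hX (B.isSmoothField_F hY) hZ x
    simpa only [g_apply, F_F, hF X Y hX hY x] using h1
  · exact fun x v hv w hw ↦ ht x v w (B.F_of_mem₁ hv) (B.F_of_mem₂ hw)
  · intro X Y Z hX hY hZ x
    have h1 := h.1 X _ Z hX (B.isSmoothField_F hY) hZ x
    simpa only [g_apply, h.parallelEndo X Y hX hY x] using h1
  · exact fun x v w hv hw ↦ h.2.2.2 x v (B.mem_D₁_iff_F.2 hv) w (B.mem_D₂_iff_F.2 hw)

end AlmostBiLagrangian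

/-! ### Torsion of symplectic connections -/

theorem SymplecticForm.cyclic_tor [T2Space M] (Ω : SymplecticForm E M) {C : LinearConnection E M}
    (h : C.ParallelForm (fun x v w ↦ Ω.form x v w)) {x : M} (u v w : TangentSpace 𝓘(ℝ, E) x) :
    Ω.form x (C.tor x u v) w + Ω.form x (C.tor x v w) u + Ω.form x (C.tor x w u) v = 0 := by
  obtain ⟨X, hX, rfl⟩ := exists_smoothField u
  obtain ⟨Y, hY, rfl⟩ := exists_smoothField v
  obtain ⟨Z, hZ, rfl⟩ := exists_smoothField w
  have h0 := Ω.closed X Y Z hX hY hZ x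
  have h1 := h X Y Z hX hY hZ x
  have h2 := h Y Z X hY hZ hX x
  have h3 := h Z X Y hZ hX hY x
  beta_reduce at h1 h2 h3
  rw [Ω.neg_swap (Y x)] at h1
  rw [Ω.neg_swap (Z x)] at h2
  rw [Ω.neg_swap (X x)] at h3
  rw [C.tor_apply (hX.mdifferentiableAt x) (hY.mdifferentiableAt x),
    C.tor_apply (hY.mdifferentiableAt x) (hZ.mdifferentiableAt x),
    C.tor_apply (hZ.mdifferentiableAt x) (hX.mdifferentiableAt x)]
  simp only [map_sub, sub_apply]
  linear_combination h0 - h1 - h2 - h3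

namespace AlmostBiLagrangian

variable {B : AlmostBiLagrangian E M n} {X Y Z : Π x : M, TangentSpace 𝓘(ℝ, E) x}
  {x : M} {C C' : LinearConnection E M}

theorem tor_mem₁ [T2Space M] (h : C.ParallelDistribution B.D₁) (hI : IsInvolutive B.D₁)
    {v w : TangentSpace 𝓘(ℝ, E) x} (hv : v ∈ B.D₁ x) (hw : w ∈ B.D₁ x) :
    C.tor x v w ∈ B.D₁ x := by
  obtain ⟨X, hX, hXD, rfl⟩ := B.exists_smoothField_mem₁ hv
  obtain ⟨Y, hY, hYD, rfl⟩ := B.exists_smoothField_mem₁ hw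
  rw [C.tor_apply (hX.mdifferentiableAt x) (hY.mdifferentiableAt x)]
  exact sub_mem (sub_mem (h X Y hX hY hYD x) (h Y X hY hX hXD x)) (hI X Y hX hY hXD hYD x)

theorem eq_zero_of_mem₁ {v : TangentSpace 𝓘(ℝ, E) x} (hv : v ∈ B.D₁ x)
    (h : ∀ w ∈ B.D₂ x, B.Ω.form x v w = 0) : v = 0 := by
  refine B.Ω.nondegenerate x _ fun w ↦ ?_
  rw [← B.proj_of_mem₁ hv, form_proj_left, B.proj_of_mem₁ hv]
  exact h _ (B.swap.proj_mem w)

theorem IsAlmostBiLagrangianConnection.tor_eq_zero_of_mem₁ [T2Space M]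
    (h : B.IsAlmostBiLagrangianConnection C) (hI : IsInvolutive B.D₁)
    {v w : TangentSpace 𝓘(ℝ, E) x} (hv : v ∈ B.D₁ x) (hw : w ∈ B.D₁ x) : C.tor x v w = 0 := by
  refine eq_zero_of_mem₁ (tor_mem₁ h.2.1 hI hv hw) fun u hu ↦ ?_
  have h1 := B.Ω.cyclic_tor h.1 v w u
  rw [h.2.2.2 x w hw u hu, C.tor_antisymm u, h.2.2.2 x v hv u hu] at h1
  simpa using h1

theorem tor_eq_zero_of_components (h1 : ∀ v ∈ B.D₁ x, ∀ w ∈ B.D₁ x, C.tor x v w = 0)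
    (h2 : ∀ v ∈ B.D₂ x, ∀ w ∈ B.D₂ x, C.tor x v w = 0)
    (h3 : ∀ v ∈ B.D₁ x, ∀ w ∈ B.D₂ x, C.tor x v w = 0) : C.tor x = 0 := by
  refine ContinuousLinearMap.ext fun v ↦ ContinuousLinearMap.ext fun w ↦ ?_
  rw [← B.proj_add_proj_swap v, ← B.proj_add_proj_swap w]
  simp only [map_add, add_apply]
  rw [h1 _ (B.proj_mem v) _ (B.proj_mem w), h2 _ (B.swap.proj_mem v) _ (B.swap.proj_mem w),
    h3 _ (B.proj_mem v) _ (B.swap.proj_mem w), C.tor_antisymm (B.swap.proj x v),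
    h3 _ (B.proj_mem w) _ (B.swap.proj_mem v)]
  simp

theorem IsAlmostBiLagrangianConnection.tor_eq_zero [T2Space M]
    (h : B.IsAlmostBiLagrangianConnection C) (hI : B.IsBiLagrangian) (x : M) : C.tor x = 0 :=
  tor_eq_zero_of_components (B := B) (fun _ hv _ hw ↦ h.tor_eq_zero_of_mem₁ hI.1 hv hw)
    (fun _ hv _ hw ↦ h.swap.tor_eq_zero_of_mem₁ hI.2 hv hw) (fun v hv w hw ↦ h.2.2.2 x v hv w hw)

theorem isBiLagrangianConnection_iff [T2Space M] (hI : B.IsBiLagrangian) :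
    B.IsBiLagrangianConnection C ↔ B.IsAlmostBiLagrangianConnection C :=
  ⟨fun h ↦ ⟨h.2.1, h.2.2.1, h.2.2.2, fun x v _ w _ ↦ by rw [h.1 x]; rfl⟩,
    fun h ↦ ⟨h.tor_eq_zero hI, h.1, h.2.1, h.2.2.1⟩⟩

/-! ### The Levi-Civita and the natural connection -/

theorem IsAlmostBiLagrangianConnection.isLeviCivita [T2Space M]
    (h : B.IsAlmostBiLagrangianConnection C) (hI : B.IsBiLagrangian) : C.IsLeviCivita B.g :=
  ⟨h.tor_eq_zero hI, (isLibermann_iff.2 h).2.1⟩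

theorem coincide_of_isLeviCivita [T2Space M] (h : C.IsLeviCivita B.g) (h' : C'.IsLeviCivita B.g) :
    C.Coincide C' := by
  have symm {X Y : Π x : M, TangentSpace 𝓘(ℝ, E) x} (hX : IsSmoothField X) (hY : IsSmoothField Y)
      (x : M) : C.deriv X Y x - C'.deriv X Y x = C.deriv Y X x - C'.deriv Y X x := by
    have e := C.tor_apply (hX.mdifferentiableAt x) (hY.mdifferentiableAt x)
    have e' := C'.tor_apply (hX.mdifferentiableAt x) (hY.mdifferentiableAt x)
    rw [h.1 x] at e
    rw [h'.1 x, ← h.1 x, h.1 x, e] at e'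
    rw [sub_eq_sub_iff_sub_eq_sub]
    exact sub_left_inj.1 e'
  have skew {X Y Z : Π x : M, TangentSpace 𝓘(ℝ, E) x} (hX : IsSmoothField X)
      (hY : IsSmoothField Y) (hZ : IsSmoothField Z) (x : M) :
      B.g x (C.deriv X Y x - C'.deriv X Y x) (Z x) =
        -B.g x (C.deriv X Z x - C'.deriv X Z x) (Y x) := by
    have e := h.2 X Y Z hX hY hZ x
    have e' := h'.2 X Y Z hX hY hZ x
    beta_reduce at e e'
    rw [(B.almostParaHermitian x (Y x) _).1] at e e'
    simp only [map_sub, LinearMap.sub_apply]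
    linarith
  intro X Y hX hY
  refine funext fun x ↦ sub_eq_zero.1 ((B.almostParaHermitian x _ 0).2.2 fun u ↦ ?_)
  obtain ⟨Z, hZ, rfl⟩ := exists_smoothField u
  have e1 := skew hX hY hZ x
  have e2 := skew hZ hX hY x
  have e3 := skew hY hZ hX x
  rw [symm hX hZ] at e1
  rw [symm hZ hY] at e2
  rw [symm hY hX] at e3
  linarith

theorem isTheUnique_isLeviCivita [T2Space M] (hI : B.IsBiLagrangian) :
    LinearConnection.IsTheUnique (LinearConnection.IsLeviCivita B.g) B.canonicalConnection :=
  have h := isTheUnique_isAlmostBiLagrangianConnection.1.isLeviCivita hI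
  ⟨h, fun _ h' ↦ coincide_of_isLeviCivita h' h⟩

theorem isTheUnique_isNatural [T2Space M] (hI : B.IsBiLagrangian) :
    LinearConnection.IsTheUnique (LinearConnection.IsNatural B.g B.F) B.canonicalConnection := by
  have h : B.IsAlmostBiLagrangianConnection B.canonicalConnection :=
    isTheUnique_isAlmostBiLagrangianConnection.1
  have key {X Y : Π x : M, TangentSpace 𝓘(ℝ, E) x} (hX : IsSmoothField X) (hY : IsSmoothField Y)
      (x : M) : B.canonicalConnection.deriv X Y x = (1 / 2 : ℝ) •
        (B.canonicalConnection.deriv X Y x +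
          B.F x (B.canonicalConnection.deriv X (fun y ↦ B.F y (Y y)) x)) := by
    rw [h.parallelEndo X Y hX hY x, F_F, ← two_smul ℝ, smul_smul]
    norm_num
  refine ⟨⟨_, h.isLeviCivita hI, fun X Y hX hY x ↦ key hX hY x⟩, fun C' ⟨L, hL, hC'⟩ ↦ ?_⟩
  have hc := coincide_of_isLeviCivita hL (h.isLeviCivita hI)
  refine fun X Y hX hY ↦ funext fun x ↦ ?_
  rw [hC' X Y hX hY, hc X Y hX hY, hc X _ hX (B.isSmoothField_F hY), ← key hX hY]

end AlmostBiLagrangian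

end

section

variable {E : Type*} [NormedAddCommGroup E] [NormedSpace ℝ E]
  {M : Type*} [TopologicalSpace M] [ChartedSpace E M]

variable [IsManifold 𝓘(ℝ, E) ∞ M] [FiniteDimensional ℝ E] {n : ℕ}

/-! ### Tensorial defects of a connection -/

theorem TensorialAt.eq_zero_of_frame {A : Type*} [AddCommGroup A] [Module ℝ A] [TopologicalSpace A]
    [IsTopologicalAddGroup A] [ContinuousSMul ℝ A] {Φ : (Π x : M, TangentSpace 𝓘(ℝ, E) x) → A}
    {x : M} (hΦ : TensorialAt 𝓘(ℝ, E) E Φ x) {ι : Type*}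
    (b : Basis ι ℝ (TangentSpace 𝓘(ℝ, E) x)) {s : ι → Π x : M, TangentSpace 𝓘(ℝ, E) x}
    (hs : ∀ i, MDiffAt (T% (s i)) x) (hb : ∀ i, b i = s i x) (h : ∀ i, Φ (s i) = 0)
    {Y : Π x : M, TangentSpace 𝓘(ℝ, E) x} (hY : MDiffAt (T% Y) x) : Φ Y = 0 := by
  have h0 : (TensorialAt.mkHom Φ x hΦ).toLinearMap = 0 := b.ext fun i ↦ by
    rw [hb, LinearMap.zero_apply, ← h i]
    exact TensorialAt.mkHom_apply hΦ (hs i)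
  rw [← TensorialAt.mkHom_apply hΦ hY]
  exact LinearMap.congr_fun h0 (Y x)

namespace LinearConnection

variable (C : LinearConnection E M) {X Y Y' : Π x : M, TangentSpace 𝓘(ℝ, E) x} {x : M}

theorem deriv_smul {f : M → ℝ} (hf : MDiffAt f x) (hY : MDiffAt (T% Y) x) :
    C.deriv X (f • Y) x = f x • C.deriv X Y x + dirDeriv X f x • Y x := by
  simp only [deriv, dirDeriv, C.cov.isCovariantDerivativeOnUniv.leibniz hY hf, add_apply,
    smul_apply, ContinuousLinearMap.smulRight_apply]

theorem deriv_congr (hY : MDiffAt (T% Y) x) (hY' : MDiffAt (T% Y') x) (h : ∀ᶠ y in 𝓝 x, Y y = Y' y) :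
    C.deriv X Y x = C.deriv X Y' x := by
  simp only [deriv]
  rw [C.cov.isCovariantDerivativeOnUniv.congr_of_eventuallyEq hY hY' Filter.univ_mem h]

/-- The defect of `∇ ω = 0`. -/
def formDefect (Ω : SymplecticForm E M) (X Y Z : Π x : M, TangentSpace 𝓘(ℝ, E) x) (x : M) : ℝ :=
  dirDeriv X (fun y ↦ Ω.form y (Y y) (Z y)) x - Ω.form x (C.deriv X Y x) (Z x) -
    Ω.form x (Y x) (C.deriv X Z x)

theorem formDefect_swap (Ω : SymplecticForm E M) (X Y Z : Π x : M, TangentSpace 𝓘(ℝ, E) x) :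
    C.formDefect Ω X Z Y x = -C.formDefect Ω X Y Z x := by
  have h1 : (fun y ↦ Ω.form y (Z y) (Y y)) = fun y ↦ -Ω.form y (Y y) (Z y) :=
    funext fun y ↦ Ω.neg_swap _ _
  rw [formDefect, formDefect, h1, dirDeriv_neg, Ω.neg_swap (C.deriv X Z x), Ω.neg_swap (Z x)]
  ring

theorem tensorialAt_formDefect (Ω : SymplecticForm E M) {X Z : Π x : M, TangentSpace 𝓘(ℝ, E) x}
    (hZ : MDiffAt (T% Z) x) : TensorialAt 𝓘(ℝ, E) E (fun Y ↦ C.formDefect Ω X Y Z x) x where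
  smul {f Y} hf hY := by
    have h := dirDeriv_mul (X := X) hf (Ω.mdifferentiableAt_apply hY hZ)
    simp only [formDefect, C.deriv_smul hf hY, Pi.smul_apply', map_add, map_smul, add_apply,
      smul_apply, smul_eq_mul, h]
    ring
  add {Y Y'} hY hY' := by
    have h := dirDeriv_add (X := X) (Ω.mdifferentiableAt_apply hY hZ)
      (Ω.mdifferentiableAt_apply hY' hZ)
    simp only [formDefect, C.deriv_add hY hY', Pi.add_apply, map_add, add_apply, h]
    ring

theorem formDefect_eq_zero_of_frame (Ω : SymplecticForm E M) {ι : Type*}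
    (b : Basis ι ℝ (TangentSpace 𝓘(ℝ, E) x)) {s : ι → Π x : M, TangentSpace 𝓘(ℝ, E) x}
    (hs : ∀ i, MDiffAt (T% (s i)) x) (hb : ∀ i, b i = s i x)
    (h : ∀ i j, C.formDefect Ω X (s i) (s j) x = 0) {Y Z : Π x : M, TangentSpace 𝓘(ℝ, E) x}
    (hY : MDiffAt (T% Y) x) (hZ : MDiffAt (T% Z) x) : C.formDefect Ω X Y Z x = 0 :=
  TensorialAt.eq_zero_of_frame (C.tensorialAt_formDefect Ω hZ) b hs hb (fun i ↦ by
    rw [formDefect_swap, TensorialAt.eq_zero_of_frame (C.tensorialAt_formDefect Ω (hs i)) b hs hb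
      (fun j ↦ h j i) hZ, neg_zero]) hY

theorem ParallelForm.formDefect_eq_zero [T2Space M] {Ω : SymplecticForm E M} {C : LinearConnection E M}
    (h : C.ParallelForm (fun x v w ↦ Ω.form x v w)) (hX : IsSmoothField X)
    {Y Z : Π x : M, TangentSpace 𝓘(ℝ, E) x}
    (hY : MDiffAt (T% Y) x) (hZ : MDiffAt (T% Z) x) : C.formDefect Ω X Y Z x = 0 := by
  obtain ⟨Y', hY', e⟩ := exists_smoothField (Y x)
  obtain ⟨Z', hZ', e'⟩ := exists_smoothField (Z x)
  have h1 := (C.tensorialAt_formDefect Ω (X := X) hZ).pointwise hY (hY'.mdifferentiableAt x) e.symm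
  have h2 := (C.tensorialAt_formDefect Ω (X := X) (hY'.mdifferentiableAt x)).pointwise hZ
    (hZ'.mdifferentiableAt x) e'.symm
  have h3 := h X Y' Z' hX hY' hZ' x
  beta_reduce at h1 h2 h3
  rw [h1, formDefect_swap, h2, formDefect_swap, formDefect, h3]
  ring

variable (B : AlmostBiLagrangian E M n)

/-- The defect of `∇ F = 0`. -/
def endoDefect (X Y : Π x : M, TangentSpace 𝓘(ℝ, E) x) (x : M) : TangentSpace 𝓘(ℝ, E) x :=
  C.deriv X (fun y ↦ B.F y (Y y)) x - B.F x (C.deriv X Y x)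

theorem tensorialAt_endoDefect (X : Π x : M, TangentSpace 𝓘(ℝ, E) x) :
    TensorialAt 𝓘(ℝ, E) E (fun Y ↦ C.endoDefect B X Y x) x where
  smul {f Y} hf hY := by
    have h : (fun y ↦ B.F y ((f • Y) y)) = f • fun y ↦ B.F y (Y y) :=
      funext fun y ↦ map_smul (B.F y) _ _
    simp only [endoDefect, h, C.deriv_smul hf (B.mdifferentiableAt_F hY), C.deriv_smul hf hY,
      map_add, map_smul, smul_sub]
    abel
  add {Y Y'} hY hY' := by
    have h : (fun y ↦ B.F y ((Y + Y') y)) = (fun y ↦ B.F y (Y y)) + fun y ↦ B.F y (Y' y) :=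
      funext fun y ↦ map_add (B.F y) _ _
    simp only [endoDefect, h, C.deriv_add (B.mdifferentiableAt_F hY) (B.mdifferentiableAt_F hY'),
      C.deriv_add hY hY', map_add]
    abel

variable {B C} in
theorem ParallelEndo.endoDefect_eq_zero [T2Space M] (h : C.ParallelEndo B.F) (hX : IsSmoothField X)
    (hY : MDiffAt (T% Y) x) : C.endoDefect B X Y x = 0 := by
  obtain ⟨Y', hY', e⟩ := exists_smoothField (Y x)
  have h1 := (C.tensorialAt_endoDefect B X).pointwise hY (hY'.mdifferentiableAt x) e.symm
  beta_reduce at h1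
  rw [h1, endoDefect, h X Y' hX hY' x, sub_self]

end LinearConnection

namespace AlmostBiLagrangian

variable {B : AlmostBiLagrangian E M n} {X Y Z : Π x : M, TangentSpace 𝓘(ℝ, E) x}
  {x : M} {C C' : LinearConnection E M}

/-! ### Adapted frames -/

theorem _root_.BiLag.SymplecticForm.ext_of_basis (Ω : SymplecticForm E M) {ι : Type*}
    (b : Basis ι ℝ (TangentSpace 𝓘(ℝ, E) x)) {v w : TangentSpace 𝓘(ℝ, E) x}
    (h : ∀ k, Ω.form x v (b k) = Ω.form x w (b k)) : v = w :=
  Ω.ext_of_form fun u ↦ LinearMap.congr_fun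
    (b.ext h : (Ω.form x v).toLinearMap = (Ω.form x w).toLinearMap) u

/-- A family of vectors is given by a matrix of the paraunitary Lie algebra in an adapted frame. -/
theorem exists_matrix_iff {b : Basis (Fin n ⊕ Fin n) ℝ (TangentSpace 𝓘(ℝ, E) x)}
    (hb : b ∈ B.adaptedFrames x) (w : Fin n ⊕ Fin n → TangentSpace 𝓘(ℝ, E) x) :
    (∃ A ∈ paraunitaryLieAlgebra n, ∀ j, w j = ∑ i, A i j • b i) ↔
      (∀ i, w (Sum.inl i) ∈ B.D₁ x) ∧ (∀ i, w (Sum.inr i) ∈ B.D₂ x) ∧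
      ∀ i j, B.Ω.form x (w (Sum.inl i)) (b (Sum.inr j)) +
        B.Ω.form x (b (Sum.inl i)) (w (Sum.inr j)) = 0 := by
  obtain ⟨hb1, hb2, hb3⟩ := hb
  constructor
  · rintro ⟨_, ⟨A, rfl⟩, h⟩
    have hl (j) : w (Sum.inl j) = ∑ i, A i j • b (Sum.inl i) := by
      rw [h]; simp
    have hr (j) : w (Sum.inr j) = ∑ i, -(A j i • b (Sum.inr i)) := by
      rw [h]; simp
    refine ⟨fun i ↦ ?_, fun i ↦ ?_, fun i j ↦ ?_⟩
    · rw [hl]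
      exact sum_mem fun k _ ↦ Submodule.smul_mem _ _ (hb1 k)
    · rw [hr]
      exact sum_mem fun k _ ↦ neg_mem (Submodule.smul_mem _ _ (hb2 k))
    · rw [hl, hr]
      simp [map_sum, hb3]
  · rintro ⟨h1, h2, h3⟩
    refine ⟨_, ⟨Matrix.of fun k i ↦ B.Ω.form x (w (Sum.inl i)) (b (Sum.inr k)), rfl⟩, ?_⟩
    rintro (j | j)
    · refine B.Ω.ext_of_basis b ?_
      rintro (k | k)
      · rw [B.isotropic₁ x _ (h1 j) _ (hb1 k)]
        simp [map_sum, B.isotropic₁ x _ (hb1 _) _ (hb1 k)]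
      · simp [map_sum, hb3]
    · refine B.Ω.ext_of_basis b ?_
      rintro (k | k)
      · have := h3 k j
        have e (i) := B.Ω.neg_swap (b (Sum.inr i)) (b (Sum.inl k))
        simp only [hb3] at e
        rw [B.Ω.neg_swap, ← eq_neg_of_add_eq_zero_left this]
        simp [map_sum, e]
      · rw [B.isotropic₂ x _ (h2 j) _ (hb2 k)]
        simp [map_sum, B.isotropic₂ x _ (hb2 _) _ (hb2 k)]

variable (B) in
theorem exists_adapted_localFrame (x : M) : ∃ (U : Set M) (s : Fin n ⊕ Fin n →
    Π x : M, TangentSpace 𝓘(ℝ, E) x), IsOpen U ∧ x ∈ U ∧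
      ∃ hs : IsLocalFrameOn 𝓘(ℝ, E) E ∞ s U, ∀ y (hy : y ∈ U),
        hs.toBasisAt hy ∈ B.adaptedFrames y := by
  obtain ⟨U, s, hU, hx, hs, hD⟩ := B.exists_localFrame x
  have hu (j : Fin n) (y : M) : ∃ u : TangentSpace 𝓘(ℝ, E) y,
      ∀ w, B.Ω.form y u w = -hs.coeff (Sum.inl j) y w := by
    let e := (B.Ω.bilin y).toDual (B.Ω.bilin_nondegenerate y)
    exact ⟨e.symm (-hs.coeff (Sum.inl j) y), fun w ↦
      LinearMap.congr_fun (e.apply_symm_apply (-hs.coeff (Sum.inl j) y)) w⟩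
  choose u hu using hu
  have hc (j : Fin n) (k) {y : M} (hy : y ∈ U) :
      B.Ω.form y (u j y) (s k y) = if k = Sum.inl j then -1 else 0 := by
    rw [hu, hs.coeff_apply_of_mem hy (s k), ← hs.toBasisAt_coe hy, Basis.repr_self,
      Finsupp.single_apply]
    split_ifs <;> simp
  have hsm (j : Fin n) {y : M} (hy : y ∈ U) : CMDiffAt ∞ (T% (u j)) y := by
    refine contMDiffAt_of_form_frame B.Ω hs hU hy fun k ↦ ?_
    refine (contMDiffAt_const (c := if k = Sum.inl j then (-1 : ℝ) else 0)).congr_of_eventuallyEq ?_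
    filter_upwards [hU.mem_nhds hy] with z hz
    exact hc j k hz
  let s' : Fin n ⊕ Fin n → Π x : M, TangentSpace 𝓘(ℝ, E) x :=
    Sum.elim (fun i ↦ s (Sum.inl i)) (fun j ↦ B.swap.projField (u j))
  have hp {y : M} (hy : y ∈ U) (i j : Fin n) :
      B.Ω.form y (s (Sum.inl i) y) (B.swap.projField (u j) y) = if i = j then 1 else 0 := by
    have h1 := B.form_proj_left (s (Sum.inl i) y) (u j y)
    rw [B.proj_of_mem₁ ((hD y hy).1 i)] at h1
    refine h1.symm.trans ?_
    rw [B.Ω.neg_swap, hc j _ hy]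
    simp only [Sum.inl.injEq]
    split_ifs <;> simp
  have hli {y : M} (hy : y ∈ U) : LinearIndependent ℝ (s' · y) := by
    refine Fintype.linearIndependent_iff.2 fun a ha ↦ ?_
    rw [Fintype.sum_sum_type] at ha
    simp only [s', Sum.elim_inl, Sum.elim_inr] at ha
    rintro (i | i)
    · have h1 := congrArg (fun v ↦ B.Ω.form y v (B.swap.projField (u i) y)) ha
      simpa [map_sum, hp hy, B.form_swap_projField] using h1
    · have h1 := congrArg (fun v ↦ B.Ω.form y (s (Sum.inl i) y) v) ha
      simpa [map_sum, hp hy, B.isotropic₁ y _ ((hD y hy).1 _) _ ((hD y hy).1 _)] using h1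
  have hs' : IsLocalFrameOn 𝓘(ℝ, E) E ∞ s' U := by
    refine ⟨hli, fun {y} hy ↦ ?_, ?_⟩
    · exact ((hli hy).span_eq_top_of_card_eq_finrank'
        (finrank_eq_card_basis (hs.toBasisAt hy)).symm).ge
    · rintro (i | i)
      · exact hs.contMDiffOn (Sum.inl i)
      · exact fun y hy ↦ (B.swap.contMDiffAt_projField (hsm i hy)).contMDiffWithinAt
  refine ⟨U, s', hU, hx, hs', fun y hy ↦ ⟨fun i ↦ ?_, fun i ↦ ?_, fun i j ↦ ?_⟩⟩
  · rw [hs'.toBasisAt_coe]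
    exact (hD y hy).1 i
  · rw [hs'.toBasisAt_coe]
    exact B.swap.projField_mem
  · rw [hs'.toBasisAt_coe, hs'.toBasisAt_coe]
    exact hp hy i j

end AlmostBiLagrangian

end

section

variable {E : Type*} [NormedAddCommGroup E] [NormedSpace ℝ E]
  {M : Type*} [TopologicalSpace M] [ChartedSpace E M]

variable [IsManifold 𝓘(ℝ, E) ∞ M] [FiniteDimensional ℝ E] {n : ℕ}

namespace AlmostBiLagrangian

variable {B : AlmostBiLagrangian E M n} {X Y Z : Π x : M, TangentSpace 𝓘(ℝ, E) x}
  {x : M} {C C' : LinearConnection E M}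

/-! ### Well-adapted connections -/

theorem isAdapted_of_parallel [T2Space M] (hF : C.ParallelEndo B.F)
    (hω : C.ParallelForm (fun x v w ↦ B.Ω.form x v w)) :
    C.IsAdapted B.adaptedFrames (paraunitaryLieAlgebra n) := by
  intro U s hU hs hP x hx v
  obtain ⟨X, hX, rfl⟩ := exists_smoothField v
  have hd (i) : MDiffAt (T% (s i)) x := (hs.contMDiffAt hU hx i).mdifferentiableAt (by simp)
  have hl {y} (hy : y ∈ U) (i : Fin n) : s (Sum.inl i) y ∈ B.D₁ y := by
    simpa using (hP y hy).1 i
  have hr {y} (hy : y ∈ U) (i : Fin n) : s (Sum.inr i) y ∈ B.D₂ y := by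
    simpa using (hP y hy).2.1 i
  have h := (exists_matrix_iff (hP x hx) fun j ↦ C.deriv X (s j) x).2 ⟨fun i ↦ ?_, fun i ↦ ?_,
    fun i j ↦ ?_⟩
  · simpa only [IsLocalFrameOn.toBasisAt_coe, LinearConnection.deriv] using h
  · have h1 := hF.endoDefect_eq_zero hX (hd (Sum.inl i))
    rw [LinearConnection.endoDefect, C.deriv_congr (B.mdifferentiableAt_F (hd _)) (hd (Sum.inl i))
      (by filter_upwards [hU.mem_nhds hx] with y hy using B.F_of_mem₁ (hl hy i)), sub_eq_zero] at h1
    exact B.mem_D₁_iff_F.2 h1.symm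
  · have h1 := hF.endoDefect_eq_zero hX (hd (Sum.inr i))
    rw [LinearConnection.endoDefect, C.deriv_congr (Y' := -s (Sum.inr i))
      (B.mdifferentiableAt_F (hd _)) (mdifferentiableAt_neg_section (hd (Sum.inr i)))
      (by filter_upwards [hU.mem_nhds hx] with y hy using B.F_of_mem₂ (hr hy i)),
      C.deriv_neg (hd _), sub_eq_zero] at h1
    exact B.mem_D₂_iff_F.2 h1.symm
  · have h1 := hω.formDefect_eq_zero hX (hd (Sum.inl i)) (hd (Sum.inr j))
    rw [LinearConnection.formDefect, dirDeriv_congr (g := fun _ ↦ if i = j then 1 else 0)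
      (by filter_upwards [hU.mem_nhds hx] with y hy using by simpa using (hP y hy).2.2 i j),
      dirDeriv_const] at h1
    simp only [IsLocalFrameOn.toBasisAt_coe]
    linarith

theorem parallelEndo_of_isAdapted
    (h : C.IsAdapted B.adaptedFrames (paraunitaryLieAlgebra n)) : C.ParallelEndo B.F := by
  intro X Y hX hY x
  obtain ⟨U, s, hU, hx, hs, hP⟩ := B.exists_adapted_localFrame x
  have hd (i) : MDiffAt (T% (s i)) x := (hs.contMDiffAt hU hx i).mdifferentiableAt (by simp)
  have hw := (exists_matrix_iff (hP x hx) fun j ↦ C.deriv X (s j) x).1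
    (by simpa only [IsLocalFrameOn.toBasisAt_coe, LinearConnection.deriv] using h U s hU hs hP x hx (X x))
  refine sub_eq_zero.1 (TensorialAt.eq_zero_of_frame (C.tensorialAt_endoDefect B X)
    (hs.toBasisAt hx) hd (fun i ↦ hs.toBasisAt_coe hx i) ?_ (hY.mdifferentiableAt x))
  rintro (i | i)
  · rw [LinearConnection.endoDefect, B.F_of_mem₁ (hw.1 i), sub_eq_zero]
    refine C.deriv_congr (B.mdifferentiableAt_F (hd _)) (hd _) ?_
    filter_upwards [hU.mem_nhds hx] with y hy
    exact B.F_of_mem₁ (by simpa using (hP y hy).1 i)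
  · rw [LinearConnection.endoDefect, B.F_of_mem₂ (hw.2.1 i), sub_eq_zero, ← C.deriv_neg (hd _)]
    refine C.deriv_congr (B.mdifferentiableAt_F (hd _)) (mdifferentiableAt_neg_section (hd _)) ?_
    filter_upwards [hU.mem_nhds hx] with y hy
    exact B.F_of_mem₂ (by simpa using (hP y hy).2.1 i)

theorem parallelForm_of_isAdapted
    (h : C.IsAdapted B.adaptedFrames (paraunitaryLieAlgebra n)) :
    C.ParallelForm (fun x v w ↦ B.Ω.form x v w) := by
  intro X Y Z hX hY hZ x
  obtain ⟨U, s, hU, hx, hs, hP⟩ := B.exists_adapted_localFrame x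
  have hd (i) : MDiffAt (T% (s i)) x := (hs.contMDiffAt hU hx i).mdifferentiableAt (by simp)
  obtain ⟨hw1, hw2, hw3⟩ := (exists_matrix_iff (hP x hx) fun j ↦ C.deriv X (s j) x).1
    (by simpa only [IsLocalFrameOn.toBasisAt_coe, LinearConnection.deriv] using h U s hU hs hP x hx (X x))
  simp only [IsLocalFrameOn.toBasisAt_coe] at hw3
  have hl {y} (hy : y ∈ U) (i : Fin n) : s (Sum.inl i) y ∈ B.D₁ y := by
    simpa using (hP y hy).1 i
  have hr {y} (hy : y ∈ U) (i : Fin n) : s (Sum.inr i) y ∈ B.D₂ y := by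
    simpa using (hP y hy).2.1 i
  have hlr (i j : Fin n) : C.formDefect B.Ω X (s (Sum.inl i)) (s (Sum.inr j)) x = 0 := by
    rw [LinearConnection.formDefect, dirDeriv_congr (g := fun _ ↦ if i = j then 1 else 0)
      (by filter_upwards [hU.mem_nhds hx] with y hy using by simpa using (hP y hy).2.2 i j),
      dirDeriv_const]
    have := hw3 i j
    linarith
  have h0 := C.formDefect_eq_zero_of_frame (X := X) B.Ω (hs.toBasisAt hx) hd
    (fun i ↦ hs.toBasisAt_coe hx i) ?_ (hY.mdifferentiableAt x) (hZ.mdifferentiableAt x)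
  · rw [LinearConnection.formDefect] at h0
    beta_reduce
    linarith
  rintro (i | i) (j | j)
  · rw [LinearConnection.formDefect, dirDeriv_congr (g := fun _ ↦ 0)
      (by filter_upwards [hU.mem_nhds hx] with y hy using
        B.isotropic₁ y _ (hl hy i) _ (hl hy j)), dirDeriv_const,
      B.isotropic₁ x _ (hw1 i) _ (hl hx j), B.isotropic₁ x _ (hl hx i) _ (hw1 j)]
    simp
  · exact hlr i j
  · rw [LinearConnection.formDefect_swap, hlr, neg_zero]
  · rw [LinearConnection.formDefect, dirDeriv_congr (g := fun _ ↦ 0)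
      (by filter_upwards [hU.mem_nhds hx] with y hy using
        B.isotropic₂ y _ (hr hy i) _ (hr hy j)), dirDeriv_const,
      B.isotropic₂ x _ (hw2 i) _ (hr hx j), B.isotropic₂ x _ (hr hx i) _ (hw2 j)]
    simp

/-- The trace condition, tested on the elements `ω(·, w) v + ω(·, v) w` of the adjoint bundle. -/
theorem form_tor_add_of_isWellAdapted (h : B.IsWellAdaptedConnection C)
    (u : TangentSpace 𝓘(ℝ, E) x) {v w : TangentSpace 𝓘(ℝ, E) x} (hv : v ∈ B.D₁ x)
    (hw : w ∈ B.D₂ x) : B.Ω.form x (C.tor x u v) w + B.Ω.form x (C.tor x u w) v = 0 := by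
  let S : TangentSpace 𝓘(ℝ, E) x →ₗ[ℝ] TangentSpace 𝓘(ℝ, E) x :=
    ((B.Ω.bilin x).flip w).smulRight v + ((B.Ω.bilin x).flip v).smulRight w
  have hS (z) : S z = B.Ω.form x z w • v + B.Ω.form x z v • w := rfl
  have hmem : S ∈ LinearConnection.adjointFibre B.adaptedFrames (paraunitaryLieAlgebra n) x := by
    intro b hb
    have hex := (exists_matrix_iff hb fun j ↦ S (b j)).2 ⟨fun i ↦ ?_, fun i ↦ ?_, fun i j ↦ ?_⟩
    · obtain ⟨A, hA, hAS⟩ := hex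
      convert hA
      ext i j
      rw [LinearMap.toMatrix_apply, hAS]
      rw [b.repr_sum_self fun i ↦ A i j]
    · rw [hS, B.isotropic₁ x _ (hb.1 i) _ hv, zero_smul, add_zero]
      exact Submodule.smul_mem _ _ hv
    · rw [hS, B.isotropic₂ x _ (hb.2.1 i) _ hw, zero_smul, zero_add]
      exact Submodule.smul_mem _ _ hw
    · rw [hS, hS, B.isotropic₁ x _ (hb.1 i) _ hv, B.isotropic₂ x _ (hb.2.1 j) _ hw,
        B.Ω.neg_swap (b (Sum.inr j))]
      simp
      ring
  have ht := h.2 x S hmem u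
  have hc : S ∘ₗ (C.tor x u).toLinearMap =
      ((B.Ω.bilin x).flip w ∘ₗ (C.tor x u).toLinearMap).smulRight v +
      ((B.Ω.bilin x).flip v ∘ₗ (C.tor x u).toLinearMap).smulRight w := rfl
  rw [hc, map_add, LinearMap.trace_smulRight, LinearMap.trace_smulRight] at ht
  exact ht

theorem tor_eq_zero_of_mem₁ [T2Space M] (hω : C.ParallelForm (fun x v w ↦ B.Ω.form x v w))
    (hD : C.ParallelDistribution B.D₁) (hI : IsInvolutive B.D₁)
    (h : ∀ u, ∀ v ∈ B.D₁ x, ∀ w ∈ B.D₂ x,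
      B.Ω.form x (C.tor x u v) w + B.Ω.form x (C.tor x u w) v = 0)
    {v w : TangentSpace 𝓘(ℝ, E) x} (hv : v ∈ B.D₁ x) (hw : w ∈ B.D₁ x) : C.tor x v w = 0 := by
  refine eq_zero_of_mem₁ (tor_mem₁ hD hI hv hw) fun u hu ↦ ?_
  have h1 := B.Ω.cyclic_tor hω v w u
  have h2 := h v w hw u hu
  have h3 := h w v hv u hu
  rw [C.tor_antisymm u v] at h1
  rw [C.tor_antisymm w v] at h3
  simp only [map_neg, neg_apply] at h1 h3
  linarith

theorem IsWellAdaptedConnection.isAlmostBiLagrangianConnection [T2Space M]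
    (h : B.IsWellAdaptedConnection C) (hI : B.IsBiLagrangian) :
    B.IsAlmostBiLagrangianConnection C := by
  have hF := parallelEndo_of_isAdapted h.1
  have hω := parallelForm_of_isAdapted h.1
  have ht {x : M} (u) (v) (hv : v ∈ B.D₁ x) (w) (hw : w ∈ B.D₂ x) :=
    form_tor_add_of_isWellAdapted h u hv hw
  have h1 {x : M} {v w : TangentSpace 𝓘(ℝ, E) x} (hv : v ∈ B.D₁ x) (hw : w ∈ B.D₁ x) :
      C.tor x v w = 0 := tor_eq_zero_of_mem₁ hω hF.parallelDistribution₁ hI.1 ht hv hw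
  have h2 {x : M} {v w : TangentSpace 𝓘(ℝ, E) x} (hv : v ∈ B.D₂ x) (hw : w ∈ B.D₂ x) :
      C.tor x v w = 0 :=
    tor_eq_zero_of_mem₁ (B := B.swap) hω hF.parallelDistribution₂ hI.2
      (fun u v hv w hw ↦ (add_comm _ _).trans (ht u w hw v hv)) hv hw
  refine ⟨hω, hF.parallelDistribution₁, hF.parallelDistribution₂, fun x v hv w hw ↦ ?_⟩
  refine B.Ω.nondegenerate x _ fun u ↦ ?_
  rw [← B.proj_add_proj_swap u, map_add]
  have h3 := ht v (B.proj x u) (B.proj_mem u) w hw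
  have h4 := ht w v hv (B.swap.proj x u) (B.swap.proj_mem u)
  rw [h1 hv (B.proj_mem u)] at h3
  rw [h2 hw (B.swap.proj_mem u), C.tor_antisymm w v] at h4
  simp only [map_zero, map_neg, zero_apply, neg_apply] at h3 h4
  linarith

theorem isTheUnique_isWellAdaptedConnection [T2Space M] (hI : B.IsBiLagrangian) :
    LinearConnection.IsTheUnique B.IsWellAdaptedConnection B.canonicalConnection := by
  have h : B.IsAlmostBiLagrangianConnection B.canonicalConnection :=
    isTheUnique_isAlmostBiLagrangianConnection.1
  refine ⟨⟨isAdapted_of_parallel h.parallelEndo h.1, fun x S _ v ↦ ?_⟩,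
    fun C hC ↦ isTheUnique_isAlmostBiLagrangianConnection.2 C
      (hC.isAlmostBiLagrangianConnection hI)⟩
  rw [h.tor_eq_zero hI x, show S ∘ₗ ((0 : TangentSpace 𝓘(ℝ, E) x →L[ℝ] TangentSpace 𝓘(ℝ, E) x →L[ℝ]
    TangentSpace 𝓘(ℝ, E) x) v).toLinearMap = 0 from LinearMap.ext fun w ↦ map_zero S, map_zero]

end AlmostBiLagrangian

end

end BiLag

end

end

open BiLag
theorem mainTheorem1 {E : Type*} [NormedAddCommGroup E] [NormedSpace ℝ E] [FiniteDimensional ℝ E]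
    {M : Type*} [TopologicalSpace M] [T2Space M] [SecondCountableTopology M]
    [ChartedSpace E M] [IsManifold 𝓘(ℝ, E) ∞ M]
    (n : ℕ) (hE : Module.finrank ℝ E = 2 * n) (B : AlmostBiLagrangian E M n) :
    (∃ C : LinearConnection E M,
      LinearConnection.IsTheUnique B.IsAlmostBiLagrangianConnection C ∧ LinearConnection.IsTheUnique (LinearConnection.IsLibermann B.g B.F) C) ∧
    (B.IsBiLagrangian → ∃ C : LinearConnection E M,
      LinearConnection.IsTheUnique B.IsWellAdaptedConnection C ∧
      LinearConnection.IsTheUnique (LinearConnection.IsLibermann B.g B.F) C ∧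
      LinearConnection.IsTheUnique (LinearConnection.IsNatural B.g B.F) C ∧
      LinearConnection.IsTheUnique B.IsBiLagrangianConnection C ∧
      LinearConnection.IsTheUnique B.IsAlmostBiLagrangianConnection C ∧
      LinearConnection.IsTheUnique (LinearConnection.IsLeviCivita B.g) C) := by
  have hA := AlmostBiLagrangian.isTheUnique_isAlmostBiLagrangianConnection (B := B)
  have hL : LinearConnection.IsTheUnique (LinearConnection.IsLibermann B.g B.F)
      B.canonicalConnection :=
    ⟨AlmostBiLagrangian.isLibermann_iff.2 hA.1,
      fun C' h ↦ hA.2 C' (AlmostBiLagrangian.isLibermann_iff.1 h)⟩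
  refine ⟨⟨_, hA, hL⟩, fun hI ↦ ⟨_, AlmostBiLagrangian.isTheUnique_isWellAdaptedConnection hI, hL,
    AlmostBiLagrangian.isTheUnique_isNatural hI, ?_, hA,
    AlmostBiLagrangian.isTheUnique_isLeviCivita hI⟩⟩
  exact ⟨(AlmostBiLagrangian.isBiLagrangianConnection_iff hI).2 hA.1,
    fun C' h ↦ hA.2 C' ((AlmostBiLagrangian.isBiLagrangianConnection_iff hI).1 h)⟩
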